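/- **Conventions.** For $\lambda\in\mathbb C$ let $G_\lambda\le SL(2,\mathbb C)$ be generated by $\begin{pmatrix}1&1\\0&1\end{pmatrix}$ and $\begin{pmatrix}1&0\\ \lambda&1\end{pmatrix}$; $\lambda$ is a *relation number* if $G_\lambda$ is not a free group of rank $2$. For an integer sequence $\mathbf n=(n_1,n_2,\dots)$ define $s^{\mathbf n}_0=0$, $s^{\mathbf n}_1=1$, $s^{\mathbf n}_{j+1}(t)=n_j\,t\,s^{\mathbf n}_j(t)-s^{\mathbf n}_{j-1}(t)$. For $\lambda=-u^2$ the *minimal $u$-degree* of $\lambda$ is the least $k$ such that $s^{\mathbf n}_{k+1}(u)=0$ for some sequence $\mathbf n=(n_1,\dots,n_k)$ of nonzero integers (and $\infty$ if there is none). Let $\bar{\mathbb Z}=\mathbb Z\cup\{\infty\}\subset\bar{\mathbb C}=\mathbb C\cup\{\infty\}$. For $\lambda\ne0$ and $n_i\in\bar{\mathbb Z}\setminus\{0\}$ put $[\,]=0$ and $[n_1,\dots,n_k]=\frac{1/\lambda}{n_1+[n_2,\dots,n_k]}\in\bar{\mathbb C}$. Let $M_k\in[0,\infty]$ be $\infty$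 if $s^{\mathbf n}_{j+1}(u)=0$ for some $j<k$ and some sequence $\mathbf n$ of $j$ nonzero integers, and otherwise $M_k=\max\{|[\mathbf n]| : \mathbf n\in(\bar{\mathbb Z}\setminus\{0\})^k\}$. An *algorithm* is a program, using only the constants $0$ and $1$, that operates on finite lists of real numbers with exact arithmetic operations $+,-,\times,\div$, order tests, branching and loops (computation over $\mathbb R$ in the sense of Blum, Shub and Smale); a complex number is given to it by its real and imaginary parts. **Theorem C.** There is a single algorithm which, for every $\lambda=-u^2\in\mathbb C$ and every integer $k\ge 0$, halts on input $(\lambda,k)$ and decides whether $\lambda$ is a relation number of minimal $u$-degree $k$. If $\lambda\neq0$, then along with its verdict it outputs, for $i=0,1,\dots,k$, a natural number $N_i$, whether $M_i=\infty$, and the value $M_i^2$ if $M_i<\infty$; here, for every $i\le k$ not exceeding the minimal $u$-degree of $\lambda$, the maximum of $|[\mathbf n]|$ over $(\bar{\mathbb Z}\setminus\{0\})^i$ exists, equals $M_i$, and is attained in the bounded search region of those $\mathbf n\in(\bar{\mathbb Z}\setminus\{0\})^i$ all of whose finite entries satisfy $|n_j|\le N_i$. Moreover, for $\lambda\ne0$,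 $\lambda$ is a relation number of minimal $u$-degree $k$ if and only if $M_k=\infty$ and $M_i<\infty$ for all $i<k$. -/

import Mathlib

open Polynomial

/-! ### The groups and relation numbers -/

/-- The parabolic matrix `X`. -/
def matX : Matrix.SpecialLinearGroup (Fin 2) ℂ := ⟨!![1, 1; 0, 1], by simp⟩

/-- The parabolic matrix `Y_λ`. -/
def matY (lam : ℂ) : Matrix.SpecialLinearGroup (Fin 2) ℂ := ⟨!![1, 0; lam, 1], by simp⟩

/-- The subgroup `G_λ` of `SL(2, ℂ)` generated by `X` and `Y_λ`. -/
def groupG (lam : ℂ) : Subgroup (Matrix.SpecialLinearGroup (Fin 2) ℂ) :=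
  Subgroup.closure {matX, matY lam}

/-- `λ` is a relation number if `G_λ` is not a free group of rank two. -/
def IsRelationNumber (lam : ℂ) : Prop := ¬ Nonempty (groupG lam ≃* FreeGroup (Fin 2))

/-! ### Generalized Chebyshev polynomials and the minimal `u`-degree -/

/-- The polynomial `s^n_k(t)` of an integer sequence `n = (n_1, n_2, …)` (the value `n 0` is not
used): `s_0 = 0`, `s_1 = 1`, `s_{k+1} = n_k t s_k - s_{k-1}`. It depends on
`n_1, …, n_{k-1}` only. -/
noncomputable def chebS (n : ℕ → ℤ) : ℕ → ℤ[X]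
  | 0 => 0
  | 1 => 1
  | k + 2 => C (n (k + 1)) * X * chebS n (k + 1) - chebS n k

/-- `s^n_{k+1}(u) = 0` for some sequence `n = (n_1, …, n_k)` of `k` nonzero integers. -/
def HasRootSeq (u : ℂ) (k : ℕ) : Prop :=
  ∃ n : ℕ → ℤ, (∀ i, 1 ≤ i → i ≤ k → n i ≠ 0) ∧ aeval u (chebS n (k + 1)) = 0

/-- The minimal `u`-degree of `λ = -u²`: the least length `k` of a nonzero integer sequence with
`s^n_{k+1}(u) = 0`, and `∞` if there is none. -/
noncomputable def minUDegree (u : ℂ) : ℕ∞ := sInf ((fun k : ℕ => (k : ℕ∞)) '' {k | HasRootSeq u k})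

/-! ### Weighted continued fractions on the Riemann sphere -/

/-- Addition on `ℂ ∪ {∞}`, with value `∞` as soon as one summand is `∞`. -/
def sphereAdd (z w : OnePoint ℂ) : OnePoint ℂ :=
  z.elim OnePoint.infty fun a => w.elim OnePoint.infty fun b => ((a + b : ℂ) : OnePoint ℂ)

open Classical in
/-- The map `z ↦ (1/λ)/z` on `ℂ ∪ {∞}`, where `λ ≠ 0`; it exchanges `0` and `∞`. -/
noncomputable def sphereRecip (lam : ℂ) (z : OnePoint ℂ) : OnePoint ℂ :=
  z.elim ((0 : ℂ) : OnePoint ℂ) fun a =>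
    if a = 0 then OnePoint.infty else (((1 / lam) / a : ℂ) : OnePoint ℂ)

/-- The `λ`-weighted continued fraction `[n_1, …, n_k]`, with `[ ] = 0` and
`[n_1, n_2, …, n_k] = (1/λ) / (n_1 + [n_2, …, n_k])`, where each `n_i ∈ ℤ ∪ {∞}`. -/
noncomputable def wcf (lam : ℂ) : List (OnePoint ℤ) → OnePoint ℂ
  | [] => ((0 : ℂ) : OnePoint ℂ)
  | a :: L => sphereRecip lam (sphereAdd (a.map fun m : ℤ => (m : ℂ)) (wcf lam L))

/-- The absolute value on `ℂ ∪ {∞}`, with values in `[0, ∞]`. -/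
noncomputable def sphereAbs (z : OnePoint ℂ) : ENNReal := z.elim ⊤ fun a => ‖a‖ₑ

/-- `(ℤ ∪ {∞} ∖ {0})^k`. -/
def extSeqs (k : ℕ) : Set (List (OnePoint ℤ)) :=
  {L | L.length = k ∧ ∀ a ∈ L, a ≠ ((0 : ℤ) : OnePoint ℤ)}

/-- The bounded part of `(ℤ ∪ {∞} ∖ {0})^k`: every entry is `∞` or a nonzero integer of absolute
value at most `N`. It is a finite set. -/
def boundedSeqs (k N : ℕ) : Set (List (OnePoint ℤ)) :=
  {L | L ∈ extSeqs k ∧ ∀ m : ℤ, (m : OnePoint ℤ) ∈ L → |m| ≤ (N : ℤ)}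

open Classical in
/-- The `k`-th maximum absolute value `M_k(λ) ∈ [0, ∞]` for `λ = -u² ≠ 0`. -/
noncomputable def wcfMax (u : ℂ) (k : ℕ) : ENNReal :=
  if ∃ j < k, HasRootSeq u j then ⊤ else sSup ((fun L => sphereAbs (wcf (-u ^ 2) L)) '' extSeqs k)

/-! ### Algorithms on real numbers

A programming language for exact computation with real numbers (in the sense of Blum, Shub and
Smale). A program is a finite syntactic object; the only constants are `0` and `1`. Its memory
is a finite list of real numbers, on which it can do field operations, order tests and loops. -/

/-- Programs. -/
inductive RealProgram : Type
  | id : RealProgram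
  | nil : RealProgram
  | zero : RealProgram
  | one : RealProgram
  | len : RealProgram
  | head : RealProgram
  | tail : RealProgram
  | add : RealProgram
  | sub : RealProgram
  | mul : RealProgram
  | div : RealProgram
  | append (f g : RealProgram) : RealProgram
  | comp (f g : RealProgram) : RealProgram
  | ifPos (c f g : RealProgram) : RealProgram
  | whilePos (c f : RealProgram) : RealProgram

/-- `RealProgram.Runs p v w`: the program `p`, started with memory `v`, halts with memory `w`
(if `p` does not halt on `v`, there is no such `w`). Missing list entries are read as `0`, and
`x / 0 = 0`. `append f g` runs `f` and `g` on the same input and juxtaposes the results, `comp f g`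
runs `g` and then `f`, `ifPos c f g` runs `f` if the first entry of the result of `c` is positive
and `g` otherwise, `whilePos c f` iterates `f` as long as the first entry of the result of `c`
is positive. -/
inductive RealProgram.Runs : RealProgram → List ℝ → List ℝ → Prop
  | id (v : List ℝ) : Runs .id v v
  | nil (v : List ℝ) : Runs .nil v []
  | zero (v : List ℝ) : Runs .zero v [0]
  | one (v : List ℝ) : Runs .one v [1]
  | len (v : List ℝ) : Runs .len v [(v.length : ℝ)]
  | head (v : List ℝ) : Runs .head v [v.getD 0 0]
  | tail (v : List ℝ) : Runs .tail v v.tail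
  | add (v : List ℝ) : Runs .add v [v.getD 0 0 + v.getD 1 0]
  | sub (v : List ℝ) : Runs .sub v [v.getD 0 0 - v.getD 1 0]
  | mul (v : List ℝ) : Runs .mul v [v.getD 0 0 * v.getD 1 0]
  | div (v : List ℝ) : Runs .div v [v.getD 0 0 / v.getD 1 0]
  | append {f g : RealProgram} {v a b : List ℝ} :
      Runs f v a → Runs g v b → Runs (.append f g) v (a ++ b)
  | comp {f g : RealProgram} {v a b : List ℝ} :
      Runs g v a → Runs f a b → Runs (.comp f g) v b
  | ifPos_true {c f g : RealProgram} {v b w : List ℝ} :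
      Runs c v b → 0 < b.getD 0 0 → Runs f v w → Runs (.ifPos c f g) v w
  | ifPos_false {c f g : RealProgram} {v b w : List ℝ} :
      Runs c v b → ¬ 0 < b.getD 0 0 → Runs g v w → Runs (.ifPos c f g) v w
  | while_stop {c f : RealProgram} {v b : List ℝ} :
      Runs c v b → ¬ 0 < b.getD 0 0 → Runs (.whilePos c f) v v
  | while_step {c f : RealProgram} {v b a w : List ℝ} :
      Runs c v b → 0 < b.getD 0 0 → Runs f v a → Runs (.whilePos c f) a w →
      Runs (.whilePos c f) v w

/-- Programs are deterministic: the final memory is determined by the initial one. -/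
theorem RealProgram.Runs.deterministic {p : RealProgram} {v w w' : List ℝ}
    (h : RealProgram.Runs p v w) (h' : RealProgram.Runs p v w') : w = w' := by
  induction h generalizing w' with
  | append _ _ ih₁ ih₂ => cases h' with
    | append h₁ h₂ => rw [ih₁ h₁, ih₂ h₂]
  | comp _ _ ih₁ ih₂ => cases h' with
    | comp h₁ h₂ => have := ih₁ h₁; subst this; exact ih₂ h₂
  | ifPos_true _ hb _ ih₁ ih₂ => cases h' with
    | ifPos_true h₁ _ h₂ => exact ih₂ h₂
    | ifPos_false h₁ hn _ => rw [ih₁ h₁] at hb; exact absurd hb hn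
  | ifPos_false _ hb _ ih₁ ih₂ => cases h' with
    | ifPos_true h₁ hp _ => rw [ih₁ h₁] at hb; exact absurd hp hb
    | ifPos_false h₁ _ h₂ => exact ih₂ h₂
  | while_stop _ hb ih₁ => cases h' with
    | while_stop _ _ => rfl
    | while_step h₁ hp _ _ => rw [ih₁ h₁] at hb; exact absurd hp hb
  | while_step _ hb _ _ ih₁ ih₂ ih₃ => cases h' with
    | while_stop h₁ hn => rw [ih₁ h₁] at hb; exact absurd hb hn
    | while_step _ _ h₂ h₃ => have := ih₂ h₂; subst this; exact ih₃ h₃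
  | _ => cases h'; rfl

open Classical in
/-- The number `1` for "true" and `0` for "false". -/
noncomputable def truthValue (p : Prop) : ℝ := if p then 1 else 0

/-!
Encode `∞` among the entries by `0`, so that continued fractions belong to integer lists, and write
`[n_1, …, n_k]` as a fraction `A / B` by the recursion `(A, B) ↦ (B, λ (n B + A))` (`cfFrac`). Up to
a power of `-u`, the denominator `B` of `[n_k, …, n_1]` is `s_{k+1}(u)` (`cfFrac_seqList_snd`).
Hence the minimal `u`-degree is the least number of entries of an infinite continued fraction
(`minUDegree_eq_iff`).

*A vanishing denominator is a relation.* For `λ ≠ 0` the denominator is, up to a power of `λ`, an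
entry of the matrix of an alternating word in `X` and `Y_λ`. It vanishes if and only if a certain
commutator (`cfRelator`) is trivial in `G_λ`. For `λ = 4` no denominator vanishes, so the commutator
is a nontrivial element of the free group. Since free groups of finite rank are Hopfian
(`FreeGroup.eq_one_of_surjective`), `G_λ` is then not even abstractly free of rank two.

*Bounding the search.* For a fixed prefix `n_1, …, n_j` the continued fraction is a Möbius
transformation of `x = n_{j+1} + w`, where `w` is the continued fraction of the remaining entries.
As a function of the real variable `n_{j+1}`, its squared absolute value is a constant plus the
quotient of a linear polynomial by a positive quadratic one. Beyond an explicit bound it is at most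
its limit, or tends to the limit monotonically from above. So an entry beyond the bound may be
replaced by the bound or by `∞` (`exists_cfAbs_le_of_prefixBound_le`). The bound depends rationally
on the prefix and on an upper bound for `|w|²`, for which the maximum `M_{i-1}²` serves as long as
it is finite. Bounding one entry after the other leaves a finite box that contains a maximal
continued fraction (`exists_mem_cfBox_cfAbs_le`). In particular `M_i` is attained, and it is
infinite if and only if some denominator vanishes.

*The program.* Functions computed by programs on representations by lists of real numbers are
closed under composition, arithmetic, case distinction, recursion and folds over lists
(`RealComputable`); the search is built from these operations. At the minimal `u`-degree the
indicator of `M_i = ∞` jumps from `0` to `1`, so its increment at `k` is the verdict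
(`truthValue_minUDegree_eq`), for `λ = 0` as well.
-/

/-! ### Free groups of finite rank are Hopfian -/

theorem FreeGroup.finite_norm_le {α : Type*} [Finite α] [DecidableEq α] (n : ℕ) :
    {x : FreeGroup α | x.norm ≤ n}.Finite :=
  (List.finite_length_le (α × Bool) n).preimage (f := FreeGroup.toWord)
    FreeGroup.toWord_injective.injOn

/-- Free groups of finite rank are residually finite. Left multiplication by a generator is a
partial injection of the ball of radius `norm w`; extend each of these to a permutation of the
ball. Under the resulting action `w` moves `1` to `w`. -/
theorem FreeGroup.exists_hom_perm_ne_one.{u} {α : Type u} [Finite α] [DecidableEq α]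
    {w : FreeGroup α} (hw : w ≠ 1) :
    ∃ (X : Type u) (_ : Finite X) (f : FreeGroup α →* Equiv.Perm X), f w ≠ 1 := by
  classical
  set n := w.norm with hn
  let X := {x : FreeGroup α | x.norm ≤ n}
  have : Finite X := FreeGroup.finite_norm_le n
  have : Fintype X := Fintype.ofFinite X
  let e (i : α) : {x : X // FreeGroup.of i * x.1 ∈ X} ≃ {x : X // (FreeGroup.of i)⁻¹ * x.1 ∈ X} :=
    { toFun := fun x => ⟨⟨FreeGroup.of i * x.1.1, x.2⟩, by simp⟩
      invFun := fun x => ⟨⟨(FreeGroup.of i)⁻¹ * x.1.1, x.2⟩, by simp⟩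
      left_inv := fun x => by simp
      right_inv := fun x => by simp }
  let σ (i : α) : Equiv.Perm X := (e i).extendSubtype
  have hσ (i : α) (x : X) (hx : FreeGroup.of i * x.1 ∈ X) : (σ i x).1 = FreeGroup.of i * x.1 := by
    simp only [σ]
    rw [Equiv.extendSubtype_apply_of_mem _ x hx]
    rfl
  have hone : (1 : FreeGroup α) ∈ {x : FreeGroup α | x.norm ≤ n} := by simp
  have key : ∀ L : List (α × Bool), L.length ≤ n →
      (FreeGroup.lift σ (FreeGroup.mk L) ⟨1, hone⟩).1 = FreeGroup.mk L := by
    intro L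
    induction L with
    | nil => intro _; rw [← FreeGroup.one_eq_mk]; simp
    | cons a L ih =>
      intro hL
      have hL' : L.length ≤ n := by simp at hL; omega
      have h1 := ih hL'
      obtain ⟨i, b⟩ := a
      have hmem : FreeGroup.mk ((i, b) :: L) ∈ X :=
        (FreeGroup.norm_mk_le).trans hL
      have hmk : FreeGroup.mk ((i, b) :: L) = FreeGroup.mk [(i, b)] * FreeGroup.mk L := by
        simp [FreeGroup.mul_mk]
      cases b with
      | true =>
        have : FreeGroup.mk [(i, true)] = FreeGroup.of i := rfl
        rw [hmk, this] at hmem ⊢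
        rw [_root_.map_mul, Equiv.Perm.mul_apply, FreeGroup.lift_apply_of, hσ _ _ (by rwa [h1]), h1]
      | false =>
        have : FreeGroup.mk [(i, false)] = (FreeGroup.of i)⁻¹ := by
          simp [FreeGroup.of, FreeGroup.inv_mk, FreeGroup.invRev]
        rw [hmk, this] at hmem ⊢
        rw [_root_.map_mul, Equiv.Perm.mul_apply, _root_.map_inv, FreeGroup.lift_apply_of]
        set y := FreeGroup.lift σ (FreeGroup.mk L) ⟨1, hone⟩ with hy
        have h2 : (σ i)⁻¹ y = ⟨(FreeGroup.of i)⁻¹ * FreeGroup.mk L, hmem⟩ := by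
          rw [Equiv.Perm.inv_eq_iff_eq]
          apply Subtype.ext
          rw [hσ]
          · simp [h1]
          · simp [← h1]
        rw [h2]
  refine ⟨X, inferInstance, FreeGroup.lift σ, fun h => hw ?_⟩
  have := key w.toWord le_rfl
  rw [FreeGroup.mk_toWord, h] at this
  exact this.symm

/-- A surjective endomorphism of a free group of finite rank is injective (the Hopf property):
precomposition with it is an injective self-map of the finite set of homomorphisms into a given
finite group, so every such homomorphism factors through it. -/
theorem FreeGroup.eq_one_of_surjective {α : Type*} [Finite α] (φ : FreeGroup α →* FreeGroup α)
    (hφ : Function.Surjective φ) {w : FreeGroup α} (hw : φ w = 1) : w = 1 := by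
  classical
  by_contra hne
  obtain ⟨X, _, f, hf⟩ := FreeGroup.exists_hom_perm_ne_one hne
  have : Finite (FreeGroup α →* Equiv.Perm X) :=
    Finite.of_equiv (α → Equiv.Perm X) FreeGroup.lift
  have hinj : Function.Injective fun g : FreeGroup α →* Equiv.Perm X => g.comp φ := by
    intro g h hgh
    exact (MonoidHom.cancel_right hφ).1 hgh
  obtain ⟨g, hg⟩ := Finite.surjective_of_injective hinj f
  apply hf
  rw [← hg]
  simp [hw]

/-! ### Relators from continued fractions -/

/-- The step of the continued fraction algorithm in homogeneous coordinates: if `v.1 / v.2` is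
`z`, then the result stands for `(1 / lam) / (x + z)`. The entry `x = 0` encodes `∞`, for which
the result is `0`. -/
noncomputable def cfStep (lam : ℂ) (x : ℝ) (v : ℂ × ℂ) : ℂ × ℂ :=
  if x = 0 then (0, 1) else (v.2, lam * (x * v.2 + v.1))

/-- The continued fraction with entries `l` (where `0` encodes `∞`) and tail `v`, as a fraction
with numerator and denominator. -/
noncomputable def cfTail (lam : ℂ) (l : List ℤ) (v : ℂ × ℂ) : ℂ × ℂ :=
  l.foldr (fun n : ℤ => cfStep lam n) v

/-- Numerator and denominator of the continued fraction with entries `l`. -/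
noncomputable def cfFrac (lam : ℂ) (l : List ℤ) : ℂ × ℂ := cfTail lam l (0, 1)

theorem cfFrac_nil (lam : ℂ) : cfFrac lam [] = (0, 1) := rfl

theorem cfFrac_cons (lam : ℂ) (n : ℤ) (l : List ℤ) :
    cfFrac lam (n :: l) = cfStep lam n (cfFrac lam l) := rfl

theorem cfFrac_cons_of_ne (lam : ℂ) {n : ℤ} (hn : n ≠ 0) (l : List ℤ) :
    cfFrac lam (n :: l) = ((cfFrac lam l).2, lam * (n * (cfFrac lam l).2 + (cfFrac lam l).1)) := by
  simp [cfFrac_cons, cfStep, hn]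

/-- The homomorphism from the free group of rank two with range `G_λ` that maps the generators to
`X` and `Y_λ`. -/
noncomputable def groupRep (lam : ℂ) :
    FreeGroup (Fin 2) →* Matrix.SpecialLinearGroup (Fin 2) ℂ :=
  FreeGroup.lift ![matX, matY lam]

/-- The word `⋯ X^{n₃} Y^{n₂} X^{n₁}` of the list `[…, n₃, n₂, n₁]`. -/
def cfWord : List ℤ → FreeGroup (Fin 2)
  | [] => 1
  | n :: l => FreeGroup.of (if Even l.length then 0 else 1) ^ n * cfWord l

open scoped commutatorElement in
/-- A commutator that is trivial in `G_λ` if and only if the denominator of the continued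
fraction vanishes. The conjugate of `Y_λ` by the word of `l` is parabolic, and it commutes with
`X` (or with `Y_λ`) if and only if it has the same fixed point. -/
def cfRelator (l : List ℤ) : FreeGroup (Fin 2) :=
  ⁅cfWord l * FreeGroup.of 1 * (cfWord l)⁻¹, FreeGroup.of (if Even l.length then 0 else 1)⁆

theorem matX_zpow (n : ℤ) : ((matX ^ n : Matrix.SpecialLinearGroup (Fin 2) ℂ) :
    Matrix (Fin 2) (Fin 2) ℂ) = !![1, (n : ℂ); 0, 1] := by
  have hpow (n : ℕ) : ((matX ^ n : Matrix.SpecialLinearGroup (Fin 2) ℂ) :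
      Matrix (Fin 2) (Fin 2) ℂ) = !![1, (n : ℂ); 0, 1] := by
    induction n with
    | zero => simp [Matrix.one_fin_two]
    | succ n ih =>
      rw [pow_succ, Matrix.SpecialLinearGroup.coe_mul, ih]
      simp [matX, add_comm]
  cases n with
  | ofNat n => simpa using hpow n
  | negSucc n =>
    rw [zpow_negSucc, Matrix.SpecialLinearGroup.coe_inv, hpow]
    simp [Matrix.adjugate_fin_two]

theorem matY_zpow (lam : ℂ) (n : ℤ) : ((matY lam ^ n : Matrix.SpecialLinearGroup (Fin 2) ℂ) :
    Matrix (Fin 2) (Fin 2) ℂ) = !![1, 0; n * lam, 1] := by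
  have hpow (n : ℕ) : ((matY lam ^ n : Matrix.SpecialLinearGroup (Fin 2) ℂ) :
      Matrix (Fin 2) (Fin 2) ℂ) = !![1, 0; n * lam, 1] := by
    induction n with
    | zero => simp [Matrix.one_fin_two]
    | succ n ih =>
      rw [pow_succ, Matrix.SpecialLinearGroup.coe_mul, ih]
      simp [matY]
      ring
  cases n with
  | ofNat n => simpa using hpow n
  | negSucc n =>
    rw [zpow_negSucc, Matrix.SpecialLinearGroup.coe_inv, hpow]
    simp [Matrix.adjugate_fin_two]
    ring

/-- Up to a power of `λ`, numerator and denominator of the continued fraction are the entries of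
the second column of the matrix of its word, in an order that depends on the parity. -/
theorem cfFrac_eq_groupRep (lam : ℂ) (l : List ℤ) (hl : ∀ n ∈ l, n ≠ 0) :
    (Even l.length → ∃ m : ℕ, cfFrac lam l =
      (lam ^ m * (groupRep lam (cfWord l)).1 0 1, lam ^ m * (groupRep lam (cfWord l)).1 1 1)) ∧
    (¬ Even l.length → ∃ m : ℕ, cfFrac lam l =
      (lam ^ m * (groupRep lam (cfWord l)).1 1 1,
        lam ^ (m + 1) * (groupRep lam (cfWord l)).1 0 1)) := by
  induction l with
  | nil => exact ⟨fun _ => ⟨0, by simp [cfFrac_nil, cfWord]⟩, fun h => absurd (by simp) h⟩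
  | cons n l ih =>
    obtain ⟨ih1, ih2⟩ := ih fun m hm => hl m (List.mem_cons_of_mem _ hm)
    have hn : n ≠ 0 := hl n (by simp)
    rw [cfFrac_cons_of_ne lam hn, List.length_cons, Nat.even_add_one]
    constructor
    · intro h
      obtain ⟨m, hm⟩ := ih2 h
      refine ⟨m + 1, ?_⟩
      simp only [cfWord, if_neg h, map_mul, map_zpow]
      rw [hm, show groupRep lam (FreeGroup.of 1) = matY lam by simp [groupRep],
        Matrix.SpecialLinearGroup.coe_mul, matY_zpow]
      simp [Matrix.mul_apply, Fin.sum_univ_two]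
      ring
    · intro h
      obtain ⟨m, hm⟩ := ih1 (not_not.1 h)
      refine ⟨m, ?_⟩
      simp only [cfWord, if_pos (not_not.1 h), map_mul, map_zpow]
      rw [hm, show groupRep lam (FreeGroup.of 0) = matX by simp [groupRep],
        Matrix.SpecialLinearGroup.coe_mul, matX_zpow]
      simp [Matrix.mul_apply, Fin.sum_univ_two]
      ring

theorem conj_matY_coe (lam : ℂ) (g : Matrix.SpecialLinearGroup (Fin 2) ℂ) :
    ((g * matY lam * g⁻¹ : Matrix.SpecialLinearGroup (Fin 2) ℂ) : Matrix (Fin 2) (Fin 2) ℂ) =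
      !![1 + lam * (g.1 0 1 * g.1 1 1), -lam * g.1 0 1 ^ 2;
        lam * g.1 1 1 ^ 2, 1 - lam * (g.1 0 1 * g.1 1 1)] := by
  have hdet := g.2
  rw [Matrix.det_fin_two] at hdet
  rw [Matrix.SpecialLinearGroup.coe_mul, Matrix.SpecialLinearGroup.coe_mul,
    Matrix.SpecialLinearGroup.coe_inv, Matrix.adjugate_fin_two]
  ext i j
  fin_cases i <;> fin_cases j <;> simp [matY, Matrix.mul_apply, Fin.sum_univ_two]
  · linear_combination hdet
  · ring
  · ring
  · linear_combination hdet

theorem conj_matY_commute_matX_iff {lam : ℂ} (hlam : lam ≠ 0)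
    (g : Matrix.SpecialLinearGroup (Fin 2) ℂ) :
    Commute (g * matY lam * g⁻¹) matX ↔ g.1 1 1 = 0 := by
  have hcoe : Commute (g * matY lam * g⁻¹) matX ↔
      ((g * matY lam * g⁻¹ * matX : Matrix.SpecialLinearGroup (Fin 2) ℂ) :
        Matrix (Fin 2) (Fin 2) ℂ) = (matX * (g * matY lam * g⁻¹) :
          Matrix.SpecialLinearGroup (Fin 2) ℂ) := Subtype.ext_iff
  rw [hcoe, Matrix.SpecialLinearGroup.coe_mul (g * matY lam * g⁻¹),
    Matrix.SpecialLinearGroup.coe_mul matX, conj_matY_coe]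
  constructor
  · intro h
    have := congrFun (congrFun h 0) 0
    simpa [matX, hlam] using this
  · intro h
    simp [matX, h, add_comm]

theorem conj_matY_commute_matY_iff {lam : ℂ} (hlam : lam ≠ 0)
    (g : Matrix.SpecialLinearGroup (Fin 2) ℂ) :
    Commute (g * matY lam * g⁻¹) (matY lam) ↔ g.1 0 1 = 0 := by
  have hcoe : Commute (g * matY lam * g⁻¹) (matY lam) ↔
      ((g * matY lam * g⁻¹ * matY lam : Matrix.SpecialLinearGroup (Fin 2) ℂ) :
        Matrix (Fin 2) (Fin 2) ℂ) = (matY lam * (g * matY lam * g⁻¹) :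
          Matrix.SpecialLinearGroup (Fin 2) ℂ) := Subtype.ext_iff
  rw [hcoe, Matrix.SpecialLinearGroup.coe_mul (g * matY lam * g⁻¹),
    Matrix.SpecialLinearGroup.coe_mul (matY lam), conj_matY_coe]
  constructor
  · intro h
    have := congrFun (congrFun h 0) 0
    simpa [matY, hlam] using this
  · intro h
    simp [matY, h, add_comm]

theorem groupRep_cfRelator_eq_one_iff {lam : ℂ} (hlam : lam ≠ 0) {l : List ℤ}
    (hl : ∀ n ∈ l, n ≠ 0) : groupRep lam (cfRelator l) = 1 ↔ (cfFrac lam l).2 = 0 := by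
  have hx : groupRep lam (FreeGroup.of 0) = matX := by simp [groupRep]
  have hy : groupRep lam (FreeGroup.of 1) = matY lam := by simp [groupRep]
  obtain ⟨h1, h2⟩ := cfFrac_eq_groupRep lam l hl
  by_cases he : Even l.length
  · obtain ⟨m, hm⟩ := h1 he
    rw [cfRelator, if_pos he, map_commutatorElement, commutatorElement_eq_one_iff_commute, hm]
    simp only [map_mul, map_inv, hx, hy]
    rw [conj_matY_commute_matX_iff hlam]
    simp [hlam]
  · obtain ⟨m, hm⟩ := h2 he
    rw [cfRelator, if_neg he, map_commutatorElement, commutatorElement_eq_one_iff_commute, hm]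
    simp only [map_mul, map_inv, hy]
    rw [conj_matY_commute_matY_iff hlam]
    simp [hlam]

/-- For `λ = 4` no denominator of a continued fraction vanishes. -/
theorem cfFrac_four_snd_ne_zero {l : List ℤ} (hl : ∀ n ∈ l, n ≠ 0) : (cfFrac 4 l).2 ≠ 0 := by
  suffices h : 2 * ‖(cfFrac 4 l).1‖ ≤ ‖(cfFrac 4 l).2‖ ∧ 0 < ‖(cfFrac 4 l).2‖ from
    norm_pos_iff.1 h.2
  induction l with
  | nil => simp [cfFrac_nil]
  | cons n l ih =>
    obtain ⟨h1, h2⟩ := ih fun m hm => hl m (List.mem_cons_of_mem _ hm)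
    have hn : n ≠ 0 := hl n (by simp)
    rw [cfFrac_cons_of_ne 4 hn]
    set A := (cfFrac 4 l).1
    set B := (cfFrac 4 l).2
    have h3 : ‖(n : ℂ) * B‖ ≤ ‖(n : ℂ) * B + A‖ + ‖A‖ := by
      simpa using norm_sub_le ((n : ℂ) * B + A) A
    have h4 : ‖B‖ ≤ ‖(n : ℂ) * B‖ := by
      rw [norm_mul, Complex.norm_intCast]
      have : (1 : ℝ) ≤ |(n : ℝ)| := by exact_mod_cast Int.one_le_abs hn
      nlinarith
    have h5 : ‖(4 : ℂ) * (n * B + A)‖ = 4 * ‖(n : ℂ) * B + A‖ := by simp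
    simp only [h5]
    constructor <;> linarith

theorem cfRelator_ne_one {l : List ℤ} (hl : ∀ n ∈ l, n ≠ 0) : cfRelator l ≠ 1 := fun h =>
  cfFrac_four_snd_ne_zero hl <| (groupRep_cfRelator_eq_one_iff (by norm_num) hl).1 (by simp [h])

/-- By the Hopf property, an abstract isomorphism of `G_λ` with the free group of rank two makes
`X` and `Y_λ` free generators. -/
theorem isRelationNumber_of_groupRep_eq_one {lam : ℂ} {w : FreeGroup (Fin 2)} (hw : w ≠ 1)
    (h : groupRep lam w = 1) : IsRelationNumber lam := by
  rintro ⟨e⟩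
  have hrange : (groupRep lam).range = groupG lam := by
    rw [groupRep, FreeGroup.range_lift_eq_closure, groupG]
    congr 1
    ext g
    simp [or_comm]
  have hmem (v : FreeGroup (Fin 2)) : groupRep lam v ∈ groupG lam := hrange ▸ ⟨v, rfl⟩
  let φ : FreeGroup (Fin 2) →* FreeGroup (Fin 2) :=
    e.toMonoidHom.comp ((groupRep lam).codRestrict (groupG lam) hmem)
  refine hw (FreeGroup.eq_one_of_surjective φ ?_ (w := w) ?_)
  · refine e.surjective.comp ?_
    rintro ⟨g, hg⟩
    rw [← hrange] at hg
    obtain ⟨v, rfl⟩ := hg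
    exact ⟨v, rfl⟩
  · have : (groupRep lam).codRestrict (groupG lam) hmem w = 1 := Subtype.ext h
    simp [φ, this]

theorem isRelationNumber_zero : IsRelationNumber 0 := by
  refine isRelationNumber_of_groupRep_eq_one (FreeGroup.of_ne_one (1 : Fin 2)) ?_
  simp only [groupRep, FreeGroup.lift_apply_of]
  apply Subtype.ext
  simp [matY, Matrix.one_fin_two]

/-- A vanishing denominator gives a relation. For `λ = 0` the relation is `Y_λ = 1`. -/
theorem isRelationNumber_of_cfFrac_snd_eq_zero {lam : ℂ} {l : List ℤ} (hl : ∀ n ∈ l, n ≠ 0)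
    (h : (cfFrac lam l).2 = 0) : IsRelationNumber lam := by
  by_cases hlam : lam = 0
  · exact hlam ▸ isRelationNumber_zero
  · exact isRelationNumber_of_groupRep_eq_one (cfRelator_ne_one hl)
      ((groupRep_cfRelator_eq_one_iff hlam hl).2 h)

/-! ### Continued fractions as fractions -/

theorem cfTail_append (lam : ℂ) (l l' : List ℤ) (v : ℂ × ℂ) :
    cfTail lam (l ++ l') v = cfTail lam l (cfTail lam l' v) := by
  simp [cfTail]

theorem cfFrac_append (lam : ℂ) (l l' : List ℤ) :
    cfFrac lam (l ++ l') = cfTail lam l (cfFrac lam l') :=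
  cfTail_append lam l l' _

theorem cfFrac_zero_cons (lam : ℂ) (l : List ℤ) : cfFrac lam (0 :: l) = (0, 1) := by
  simp [cfFrac_cons, cfStep]

/-- Entries behind an entry `∞` do not matter. -/
theorem cfTail_eq_of_zero_mem (lam : ℂ) {l : List ℤ} (h : 0 ∈ l) (v v' : ℂ × ℂ) :
    cfTail lam l v = cfTail lam l v' := by
  induction l with
  | nil => simp at h
  | cons n l ih =>
    by_cases hn : n = 0
    · simp [cfTail, cfStep, hn]
    · have := ih (by simpa [Ne.symm hn] using h)
      simp only [cfTail, List.foldr_cons] at this ⊢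
      rw [this]

theorem exists_forall_ne_zero_cfFrac_eq (lam : ℂ) (l : List ℤ) :
    ∃ l' : List ℤ, (∀ n ∈ l', n ≠ 0) ∧ l'.length ≤ l.length ∧ cfFrac lam l' = cfFrac lam l := by
  induction l with
  | nil => exact ⟨[], by simp, le_rfl, rfl⟩
  | cons n l ih =>
    by_cases hn : n = 0
    · exact ⟨[], by simp, by simp, by rw [hn, cfFrac_zero_cons, cfFrac_nil]⟩
    · obtain ⟨l', h1, h2, h3⟩ := ih
      refine ⟨n :: l', by simpa [hn] using h1, by simpa using h2, ?_⟩
      rw [cfFrac_cons, cfFrac_cons, h3]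

/-- No continued fraction with fewer than `k` entries has the value `∞`. -/
def CfRegular (lam : ℂ) (k : ℕ) : Prop := ∀ l : List ℤ, l.length < k → (cfFrac lam l).2 ≠ 0

theorem CfRegular.mono {lam : ℂ} {j k : ℕ} (h : CfRegular lam k) (hjk : j ≤ k) :
    CfRegular lam j := fun l hl => h l (hl.trans_le hjk)

/-! ### Denominators and generalized Chebyshev polynomials -/

/-- The list `[n_k, …, n_1]`. -/
def seqList (n : ℕ → ℤ) : ℕ → List ℤ
  | 0 => []
  | k + 1 => n (k + 1) :: seqList n k

theorem length_seqList (n : ℕ → ℤ) (k : ℕ) : (seqList n k).length = k := by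
  induction k with
  | zero => rfl
  | succ k ih => simp [seqList, ih]

theorem seqList_congr {n n' : ℕ → ℤ} {k : ℕ} (h : ∀ i, 1 ≤ i → i ≤ k → n i = n' i) :
    seqList n k = seqList n' k := by
  induction k with
  | zero => rfl
  | succ k ih =>
    rw [seqList, seqList, h _ (by omega) le_rfl, ih fun i h1 h2 => h i h1 (by omega)]

theorem exists_seqList_eq (l : List ℤ) : ∃ n : ℕ → ℤ, seqList n l.length = l := by
  induction l with
  | nil => exact ⟨0, rfl⟩
  | cons a l ih =>
    obtain ⟨n, hn⟩ := ih
    refine ⟨Function.update n (l.length + 1) a, ?_⟩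
    rw [List.length_cons, seqList, Function.update_self]
    congr 1
    refine (seqList_congr fun i _ hi => ?_).trans hn
    rw [Function.update_of_ne (by omega)]

theorem forall_mem_seqList_ne_zero_iff {n : ℕ → ℤ} {k : ℕ} :
    (∀ m ∈ seqList n k, m ≠ 0) ↔ ∀ i, 1 ≤ i → i ≤ k → n i ≠ 0 := by
  induction k with
  | zero => simp [seqList]; intro i h1 h2; omega
  | succ k ih =>
    rw [seqList, List.forall_mem_cons, ih]
    constructor
    · rintro ⟨h1, h2⟩ i hi hik
      rcases hik.eq_or_lt with rfl | h
      · exact h1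
      · exact h2 i hi (by omega)
    · intro h
      exact ⟨h _ (by omega) le_rfl, fun i h1 h2 => h i h1 (by omega)⟩

/-- The recursion of the denominators is that of the generalized Chebyshev polynomials. -/
theorem cfFrac_seqList_snd (u : ℂ) {n : ℕ → ℤ} {k : ℕ} (hn : ∀ i, 1 ≤ i → i ≤ k → n i ≠ 0) :
    (cfFrac (-u ^ 2) (seqList n k)).2 = (-u) ^ k * aeval u (chebS n (k + 1)) := by
  suffices h : (cfFrac (-u ^ 2) (seqList n k)).2 = (-u) ^ k * aeval u (chebS n (k + 1)) ∧
      -u * (cfFrac (-u ^ 2) (seqList n k)).1 = (-u) ^ k * aeval u (chebS n k) from h.1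
  induction k with
  | zero => simp [seqList, cfFrac_nil, chebS]
  | succ k ih =>
    obtain ⟨h1, h2⟩ := ih fun i hi hik => hn i hi (by omega)
    rw [seqList, cfFrac_cons_of_ne _ (hn (k + 1) (by omega) le_rfl)]
    refine ⟨?_, by rw [h1]; ring⟩
    simp only [chebS, map_sub, map_mul, aeval_X, h1]
    have h3 : aeval u (C (n (k + 1))) = (n (k + 1) : ℂ) := by simp
    rw [h3]
    linear_combination u * h2

theorem natCast_le_minUDegree_iff {u : ℂ} {k : ℕ} :
    (k : ℕ∞) ≤ minUDegree u ↔ ∀ j < k, ¬ HasRootSeq u j := by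
  rw [minUDegree, le_sInf_iff]
  simp only [Set.mem_image, Set.mem_ofPred_eq, forall_exists_index, and_imp,
    forall_apply_eq_imp_iff₂, Nat.cast_le]
  exact forall_congr' fun j => by rw [← not_imp_not, not_le]

theorem cfRegular_iff_forall_not_hasRootSeq {u : ℂ} {k : ℕ} :
    CfRegular (-u ^ 2) k ↔ ∀ j < k, ¬ HasRootSeq u j := by
  constructor
  · rintro h j hj ⟨n, hn, hroot⟩
    refine h (seqList n j) (by rwa [length_seqList]) ?_
    rw [cfFrac_seqList_snd u hn, hroot, mul_zero]
  · intro h l hl h0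
    obtain ⟨l', hne, hle, heq⟩ := exists_forall_ne_zero_cfFrac_eq (-u ^ 2) l
    obtain ⟨n, hn⟩ := exists_seqList_eq l'
    rw [← hn, forall_mem_seqList_ne_zero_iff] at hne
    rw [← heq, ← hn, cfFrac_seqList_snd u hne, mul_eq_zero] at h0
    rcases h0 with h0 | h0
    · -- here `u = 0`, and `s_2 = n_1 t` has the root `0`
      have hu : u = 0 := neg_eq_zero.1 (eq_zero_of_pow_eq_zero h0)
      have hpos : 1 < k := by
        have : l'.length ≠ 0 := fun h => by simp [h] at h0
        omega
      exact h 1 hpos ⟨1, by simp, by simp [chebS, hu]⟩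
    · exact h _ (by omega) ⟨n, hne, h0⟩

theorem natCast_le_minUDegree_iff_cfRegular {u : ℂ} {k : ℕ} :
    (k : ℕ∞) ≤ minUDegree u ↔ CfRegular (-u ^ 2) k :=
  natCast_le_minUDegree_iff.trans cfRegular_iff_forall_not_hasRootSeq.symm

theorem minUDegree_eq_iff {u : ℂ} {k : ℕ} :
    minUDegree u = k ↔ CfRegular (-u ^ 2) k ∧ ¬ CfRegular (-u ^ 2) (k + 1) := by
  rw [← natCast_le_minUDegree_iff_cfRegular, ← natCast_le_minUDegree_iff_cfRegular, not_le]
  constructor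
  · rintro h
    rw [h]
    exact ⟨le_rfl, by exact_mod_cast Nat.lt_succ_self k⟩
  · rintro ⟨h1, h2⟩
    refine le_antisymm ?_ h1
    exact Order.le_of_lt_add_one (by exact_mod_cast h2)

/-- A finite minimal `u`-degree yields a relation between `X` and `Y_λ`. -/
theorem isRelationNumber_of_minUDegree_eq {u : ℂ} {k : ℕ} (h : minUDegree u = k) :
    IsRelationNumber (-u ^ 2) := by
  have h2 := (minUDegree_eq_iff.1 h).2
  simp only [CfRegular, not_forall, not_not] at h2
  obtain ⟨l, -, hl⟩ := h2
  obtain ⟨l', hne, -, heq⟩ := exists_forall_ne_zero_cfFrac_eq (-u ^ 2) l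
  exact isRelationNumber_of_cfFrac_snd_eq_zero hne (by rw [heq, hl])

/-! ### Absolute values of continued fractions -/

/-- The entry in `ℤ ∪ {∞} ∖ {0}` encoded by an integer. -/
def cfEntry (n : ℤ) : OnePoint ℤ := if n = 0 then OnePoint.infty else n

theorem wcf_map_cfEntry {lam : ℂ} (hlam : lam ≠ 0) {l : List ℤ} (h : CfRegular lam l.length) :
    wcf lam (l.map cfEntry) = if (cfFrac lam l).2 = 0 then OnePoint.infty else
      (((cfFrac lam l).1 / (cfFrac lam l).2 : ℂ) : OnePoint ℂ) := by
  induction l with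
  | nil => simp [wcf, cfFrac_nil]
  | cons n l ih =>
    have hB : (cfFrac lam l).2 ≠ 0 := h l (by simp)
    rw [List.map_cons, wcf, ih (h.mono (by simp)), if_neg hB]
    by_cases hn : n = 0
    · subst hn
      simp [cfEntry, sphereAdd, sphereRecip, cfFrac_zero_cons]
    · rw [cfFrac_cons_of_ne lam hn]
      have h1 : sphereAdd ((cfEntry n).map fun m : ℤ => (m : ℂ))
          (((cfFrac lam l).1 / (cfFrac lam l).2 : ℂ) : OnePoint ℂ) =
          ((n + (cfFrac lam l).1 / (cfFrac lam l).2 : ℂ) : OnePoint ℂ) := by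
        simp [cfEntry, hn, sphereAdd]
      have h2 : lam * (n * (cfFrac lam l).2 + (cfFrac lam l).1) =
          lam * (cfFrac lam l).2 * (n + (cfFrac lam l).1 / (cfFrac lam l).2) := by
        field_simp
      rw [h1]
      simp only [sphereRecip, OnePoint.elim_some, h2]
      by_cases h3 : (n + (cfFrac lam l).1 / (cfFrac lam l).2 : ℂ) = 0
      · simp [h3]
      · rw [if_neg h3, if_neg (by simp [hlam, hB, h3])]
        congr 1
        field_simp

/-- The absolute value of the continued fraction with entries `l`, as an element of `[0, ∞]`. -/
noncomputable def cfAbs (lam : ℂ) (l : List ℤ) : ENNReal :=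
  if (cfFrac lam l).2 = 0 then ⊤ else ‖(cfFrac lam l).1 / (cfFrac lam l).2‖ₑ

/-- The squared absolute value of a finite continued fraction. -/
noncomputable def cfSq (lam : ℂ) (l : List ℤ) : ℝ :=
  Complex.normSq ((cfFrac lam l).1 / (cfFrac lam l).2)

theorem sphereAbs_wcf_map_cfEntry {lam : ℂ} (hlam : lam ≠ 0) {l : List ℤ}
    (h : CfRegular lam l.length) : sphereAbs (wcf lam (l.map cfEntry)) = cfAbs lam l := by
  rw [wcf_map_cfEntry hlam h, cfAbs]
  split_ifs <;> simp [sphereAbs]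

/-- The integer lists of length `k` with entries of absolute value at most `N`. -/
def cfBox (k N : ℕ) : Set (List ℤ) := {l | l.length = k ∧ ∀ n ∈ l, |n| ≤ (N : ℤ)}

theorem exists_map_cfEntry_eq {L : List (OnePoint ℤ)} (hL : ∀ a ∈ L, a ≠ ((0 : ℤ) : OnePoint ℤ)) :
    ∃ l : List ℤ, l.map cfEntry = L := by
  refine ⟨L.map fun a => a.elim 0 id, ?_⟩
  rw [List.map_map]
  refine (List.map_congr_left fun a ha => ?_).trans (List.map_id L)
  induction a using OnePoint.rec with
  | infty => simp [cfEntry]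
  | coe n =>
    have : n ≠ 0 := fun h => hL _ ha (by rw [h])
    simp [cfEntry, this]

theorem cfEntry_ne_zero (n : ℤ) : cfEntry n ≠ ((0 : ℤ) : OnePoint ℤ) := by
  rw [cfEntry]
  split_ifs with h
  · exact OnePoint.infty_ne_coe 0
  · simpa using h

theorem coe_eq_cfEntry_iff {m n : ℤ} : (m : OnePoint ℤ) = cfEntry n ↔ n ≠ 0 ∧ m = n := by
  rw [cfEntry]
  split_ifs with h
  · simp [h]
  · simp [h]

theorem extSeqs_eq (k : ℕ) :
    extSeqs k = (fun l => l.map cfEntry) '' {l : List ℤ | l.length = k} := by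
  ext L
  constructor
  · rintro ⟨h1, h2⟩
    obtain ⟨l, rfl⟩ := exists_map_cfEntry_eq h2
    exact ⟨l, by simpa using h1, rfl⟩
  · rintro ⟨l, h1, rfl⟩
    refine ⟨by simpa using h1, fun a ha => ?_⟩
    obtain ⟨n, -, rfl⟩ := List.mem_map.1 ha
    exact cfEntry_ne_zero n

theorem boundedSeqs_eq (k N : ℕ) : boundedSeqs k N = (fun l => l.map cfEntry) '' cfBox k N := by
  ext L
  constructor
  · rintro ⟨h1, h2⟩
    rw [extSeqs_eq] at h1
    obtain ⟨l, hl, rfl⟩ := h1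
    refine ⟨l, ⟨hl, fun n hn => ?_⟩, rfl⟩
    by_cases h0 : n = 0
    · simp [h0]
    · exact h2 n (List.mem_map.2 ⟨n, hn, (coe_eq_cfEntry_iff.2 ⟨h0, rfl⟩).symm⟩)
  · rintro ⟨l, ⟨h1, h2⟩, rfl⟩
    refine ⟨by rw [extSeqs_eq]; exact ⟨l, h1, rfl⟩, fun m hm => ?_⟩
    obtain ⟨n, hn, hmn⟩ := List.mem_map.1 hm
    rw [(coe_eq_cfEntry_iff.1 hmn.symm).2]
    exact h2 n hn

theorem image_extSeqs {lam : ℂ} (hlam : lam ≠ 0) {k : ℕ} (h : CfRegular lam k) :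
    (fun L => sphereAbs (wcf lam L)) '' extSeqs k = cfAbs lam '' {l : List ℤ | l.length = k} := by
  rw [extSeqs_eq, Set.image_image]
  exact Set.image_congr fun l hl => sphereAbs_wcf_map_cfEntry hlam (by rwa [hl])

theorem image_boundedSeqs {lam : ℂ} (hlam : lam ≠ 0) {k : ℕ} (N : ℕ) (h : CfRegular lam k) :
    (fun L => sphereAbs (wcf lam L)) '' boundedSeqs k N = cfAbs lam '' cfBox k N := by
  rw [boundedSeqs_eq, Set.image_image]
  exact Set.image_congr fun l hl => sphereAbs_wcf_map_cfEntry hlam (by rwa [hl.1])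

/-! ### Bounding the entries of a maximal continued fraction -/

/-- On `[N, ∞)` the function `(2 A t + B) / (t² + 2 r t + s)` is nonincreasing unless it is
nonpositive, so there it is bounded by its value at `N` or by its limit `0`. -/
theorem linear_div_quadratic_le_max {A B r s N t : ℝ} (hrs : r ^ 2 ≤ s) (hN : 0 < N)
    (hsN : 4 * s ≤ N ^ 2) (hAB : A = 0 ∨ 4 * |B| ≤ |A| * N) (ht : N ≤ t) :
    0 < t ^ 2 + 2 * r * t + s ∧
    (2 * A * t + B) / (t ^ 2 + 2 * r * t + s) ≤
      max 0 ((2 * A * N + B) / (N ^ 2 + 2 * r * N + s)) := by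
  have hr : 2 * |r| ≤ N := by
    refine (pow_le_pow_iff_left₀ (by positivity) hN.le two_ne_zero).1 ?_
    rw [mul_pow, sq_abs]
    linarith
  have hr1 := neg_abs_le r
  have hr2 := le_abs_self r
  have hpos : ∀ x, N ≤ x → 0 < x ^ 2 + 2 * r * x + s := fun x hx => by
    have : 0 < (x + r) ^ 2 := by
      apply pow_pos
      linarith
    nlinarith
  have hD : N ^ 2 + 2 * r * N + s ≤ t ^ 2 + 2 * r * t + s := by nlinarith
  refine ⟨hpos t ht, ?_⟩
  by_cases hneg : 2 * A * t + B ≤ 0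
  · exact le_max_of_le_left (div_nonpos_of_nonpos_of_nonneg hneg (hpos t ht).le)
  push Not at hneg
  refine le_max_of_le_right ?_
  rcases le_or_gt A 0 with hA | hA
  · refine div_le_div₀ ?_ ?_ (hpos N le_rfl) hD <;> nlinarith
  · have h4 : 4 * |B| ≤ A * N := by
      rcases hAB with h | h
      · exact absurd h hA.ne'
      · rwa [abs_of_pos hA] at h
    have hB1 := neg_abs_le B
    have hB2 := le_abs_self B
    rw [div_le_div_iff₀ (hpos t ht) (hpos N le_rfl)]
    have hBr : |B * r| ≤ |B| * N := by
      rw [abs_mul]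
      have := abs_nonneg B
      nlinarith [abs_nonneg r]
    have hBr1 := neg_abs_le (B * r)
    -- the derivative of the quotient is nonpositive at `N`
    have h1 : 0 ≤ A * N ^ 2 + B * N + B * r - A * s := by
      nlinarith [mul_le_mul_of_nonneg_left hsN hA.le]
    have h2 : 0 ≤ 2 * A * N + B := by nlinarith [mul_pos hA hN]
    have h3 : 0 ≤ (2 * A * N + B) * (t + N + 2 * r) - 2 * A * (N ^ 2 + 2 * r * N + s) := by
      nlinarith [mul_nonneg h2 (sub_nonneg.2 ht)]
    nlinarith [mul_nonneg (sub_nonneg.2 ht) h3]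

/-- A bound for the integers `n` at which `|(a (n + w) + b) / (n + w + q)|` can exceed its limit
`|a|` and all its values at integers closer to `0`, for a fixed `w` with `|w|² ≤ M`. It is a
rational function over `ℝ`, so a program can compute it. The square of the function is `|a|²` plus
the quotient of `2 A n + B` by `|n + w + q|²`, where `B` depends on `w`. If `A = 0`, then the term
`1 / A ^ 2` is `0`, as it should be. -/
noncomputable def moebiusBound (M : ℝ) (a b q : ℂ) : ℝ :=
  let A := (starRingEnd ℂ a * (b - a * q)).re
  1 + 8 * (M + Complex.normSq q) +
    4 * (4 * Complex.normSq a * M + 2 * Complex.normSq b +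
      2 * Complex.normSq a * Complex.normSq q) * (1 + 1 / A ^ 2)

theorem normSq_add_le (z w : ℂ) :
    Complex.normSq (z + w) ≤ 2 * Complex.normSq z + 2 * Complex.normSq w := by
  simp only [Complex.normSq_apply, Complex.add_re, Complex.add_im]
  nlinarith [sq_nonneg (z.re - w.re), sq_nonneg (z.im - w.im)]

theorem moebius_le_max_of_pos {M N t : ℝ} {a b q w : ℂ} (hw : Complex.normSq w ≤ M)
    (hN : moebiusBound M a b q ≤ N) (ht : N ≤ t) :
    t + w + q ≠ 0 ∧ Complex.normSq ((a * (t + w) + b) / (t + w + q)) ≤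
      max (Complex.normSq a) (Complex.normSq ((a * (N + w) + b) / (N + w + q))) := by
  set A := (starRingEnd ℂ a * (b - a * q)).re with hA
  set B := Complex.normSq (a * w + b) - Complex.normSq (a * w + a * q) with hB
  set s := Complex.normSq (w + q) with hs
  set r := (w + q).re with hr
  have hexp (x : ℝ) : Complex.normSq (x + w + q) = x ^ 2 + 2 * r * x + s := by
    simp only [hs, hr, Complex.normSq_apply, Complex.add_re, Complex.add_im, Complex.ofReal_re,
      Complex.ofReal_im]
    ring
  have hnum (x : ℝ) : Complex.normSq (a * (x + w) + b) =
      Complex.normSq a * Complex.normSq (x + w + q) + (2 * A * x + B) := by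
    simp only [hA, hB, Complex.normSq_apply, Complex.add_re, Complex.add_im, Complex.ofReal_re,
      Complex.ofReal_im, Complex.mul_re, Complex.mul_im, Complex.conj_re, Complex.conj_im,
      Complex.sub_re, Complex.sub_im]
    ring
  have ha0 := Complex.normSq_nonneg a
  have hb0 := Complex.normSq_nonneg b
  have hq0 := Complex.normSq_nonneg q
  have hw0 := Complex.normSq_nonneg w
  have hM0 : 0 ≤ M := hw0.trans hw
  set C := 4 * Complex.normSq a * M + 2 * Complex.normSq b +
    2 * Complex.normSq a * Complex.normSq q with hC
  have hC0 : 0 ≤ C := by positivity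
  have hBC : |B| ≤ C := by
    have h1 := normSq_add_le (a * w) b
    have h2 := normSq_add_le (a * w) (a * q)
    have h3 := Complex.normSq_nonneg (a * w + b)
    have h4 := Complex.normSq_nonneg (a * w + a * q)
    simp only [map_mul] at h1 h2
    have h5 := mul_le_mul_of_nonneg_left hw ha0
    have h6 := mul_nonneg ha0 hw0
    have h7 := mul_nonneg ha0 hq0
    rw [abs_le]
    constructor <;> linarith
  have hbound : 1 + 8 * (M + Complex.normSq q) + 4 * C * (1 + 1 / A ^ 2) ≤ N := hN
  have hA1 : 0 ≤ 1 / A ^ 2 := by positivity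
  have hCA : 0 ≤ 4 * C * (1 + 1 / A ^ 2) := by positivity
  have hsle : s ≤ 2 * M + 2 * Complex.normSq q := by
    have := normSq_add_le w q
    linarith
  have hs0 : 0 ≤ s := Complex.normSq_nonneg _
  have hNpos : 0 < N := by linarith
  have hsN : 4 * s ≤ N ^ 2 := by
    have h1 : 1 + 4 * s ≤ N := by linarith
    nlinarith
  have hrs : r ^ 2 ≤ s := by
    rw [hs, Complex.normSq_apply]
    nlinarith [sq_nonneg (w + q).im]
  have hAB : A = 0 ∨ 4 * |B| ≤ |A| * N := by
    by_cases h0 : A = 0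
    · exact Or.inl h0
    right
    have hApos : 0 < |A| := abs_pos.2 h0
    have h1 : 1 ≤ |A| * (1 + 1 / A ^ 2) := by
      rw [← sq_abs A]
      have h2 : |A| * (1 + 1 / |A| ^ 2) = |A| + 1 / |A| := by field_simp
      rw [h2]
      rcases le_total 1 |A| with h | h
      · have : 0 < 1 / |A| := by positivity
        linarith
      · have : 1 ≤ 1 / |A| := by rwa [le_div_iff₀ hApos, one_mul]
        linarith
    have h2 : 4 * C * (1 + 1 / A ^ 2) ≤ N := by linarith
    calc 4 * |B| ≤ 4 * C * 1 := by linarith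
      _ ≤ 4 * C * (|A| * (1 + 1 / A ^ 2)) := by gcongr
      _ = |A| * (4 * C * (1 + 1 / A ^ 2)) := by ring
      _ ≤ |A| * N := by gcongr
  have hquot (x : ℝ) (hx : 0 < x ^ 2 + 2 * r * x + s) :
      Complex.normSq ((a * (x + w) + b) / (x + w + q)) =
        Complex.normSq a + (2 * A * x + B) / (x ^ 2 + 2 * r * x + s) := by
    rw [map_div₀, hnum, hexp, add_div, mul_div_cancel_right₀ _ hx.ne']
  obtain ⟨h1, h2⟩ := linear_div_quadratic_le_max hrs hNpos hsN hAB ht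
  obtain ⟨h3, -⟩ := linear_div_quadratic_le_max hrs hNpos hsN hAB le_rfl
  refine ⟨fun h => ?_, ?_⟩
  · rw [← hexp, h, map_zero] at h1
    exact h1.ne' rfl
  · rw [hquot t h1, hquot N h3]
    rcases le_max_iff.1 h2 with h | h
    · exact le_max_of_le_left (by linarith)
    · exact le_max_of_le_right (by linarith)

theorem moebius_le_max {M N t : ℝ} {a b q w : ℂ} (hw : Complex.normSq w ≤ M)
    (hN : moebiusBound M a b q ≤ N) (ht : N ≤ |t|) :
    t + w + q ≠ 0 ∧ ∃ x : ℝ, (x = N ∨ x = -N) ∧ x + w + q ≠ 0 ∧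
      Complex.normSq ((a * (t + w) + b) / (t + w + q)) ≤
        max (Complex.normSq a) (Complex.normSq ((a * (x + w) + b) / (x + w + q))) := by
  rcases le_abs.1 ht with h | h
  · obtain ⟨h1, h2⟩ := moebius_le_max_of_pos hw hN h
    exact ⟨h1, N, Or.inl rfl, (moebius_le_max_of_pos hw hN le_rfl).1, h2⟩
  · -- reflect all of `t`, `w`, `b`, `q` at `0`
    have hw' : Complex.normSq (-w) ≤ M := by rwa [Complex.normSq_neg]
    have hN' : moebiusBound M a (-b) (-q) ≤ N := by
      refine le_of_eq_of_le ?_ hN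
      have : starRingEnd ℂ a * (-b - a * -q) = -(starRingEnd ℂ a * (b - a * q)) := by ring
      simp only [moebiusBound, this, Complex.normSq_neg, Complex.neg_re, neg_sq]
    have hrefl (x : ℝ) : ((-x : ℝ) : ℂ) + -w + -q = -(x + w + q) := by push_cast; ring
    have hrefl' (x : ℝ) : a * (((-x : ℝ) : ℂ) + -w) + -b = -(a * (x + w) + b) := by
      push_cast; ring
    obtain ⟨h1, h2⟩ := moebius_le_max_of_pos hw' hN' h
    have h3 := (moebius_le_max_of_pos hw' hN' le_rfl).1
    rw [hrefl] at h1 h2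
    have hNN : (N : ℂ) = ((- -N : ℝ) : ℂ) := by simp
    rw [hNN, hrefl] at h3
    rw [hNN, hrefl, hrefl', hrefl', neg_div_neg_eq, neg_div_neg_eq] at h2
    exact ⟨neg_ne_zero.1 h1, -N, Or.inr rfl, neg_ne_zero.1 h3, h2⟩

/-- The bound for the entry that follows a prefix, where `s` lists the continued fractions of the
prefix with tails `∞` and `0`. The value of the continued fraction is a Möbius
transformation of the rest. -/
noncomputable def prefixBound (lam : ℂ) (M : ℝ) (s : (ℂ × ℂ) × (ℂ × ℂ)) : ℝ :=
  moebiusBound M (s.2.1 / s.2.2) (s.1.1 / (lam * s.2.2)) (s.1.2 / (lam * s.2.2))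

/-- The continued fractions with entries `l` and tails `∞` and `0`. -/
noncomputable def cfPair (lam : ℂ) (l : List ℤ) : (ℂ × ℂ) × (ℂ × ℂ) :=
  (cfTail lam l (1, 0), cfTail lam l (0, 1))

theorem cfTail_eq_linear (lam : ℂ) {l : List ℤ} (hl : 0 ∉ l) (v : ℂ × ℂ) :
    cfTail lam l v = v.1 • cfTail lam l (1, 0) + v.2 • cfTail lam l (0, 1) := by
  induction l with
  | nil => simp [cfTail]
  | cons n l ih =>
    rw [List.mem_cons, not_or] at hl
    have hn : (n : ℝ) ≠ 0 := by exact_mod_cast Ne.symm hl.1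
    have hcons (v : ℂ × ℂ) : cfTail lam (n :: l) v = cfStep lam n (cfTail lam l v) := rfl
    rw [hcons, hcons, hcons, ih hl.2]
    simp only [cfStep, if_neg hn]
    ext
    · simp
    · simp
      ring

theorem cfAbs_of_ne_zero {lam : ℂ} {l : List ℤ} (h : (cfFrac lam l).2 ≠ 0) :
    cfAbs lam l = ‖(cfFrac lam l).1 / (cfFrac lam l).2‖ₑ := if_neg h

theorem enorm_le_enorm_of_normSq_le {z w : ℂ} (h : Complex.normSq z ≤ Complex.normSq w) :
    ‖z‖ₑ ≤ ‖w‖ₑ := by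
  rw [enorm_le_iff_norm_le]
  rw [Complex.normSq_eq_norm_sq, Complex.normSq_eq_norm_sq] at h
  exact (pow_le_pow_iff_left₀ (norm_nonneg z) (norm_nonneg w) two_ne_zero).1 h

/-- An entry that exceeds the bound of its prefix can be made smaller or infinite without
decreasing the absolute value of the continued fraction. -/
theorem exists_cfAbs_le_of_prefixBound_le {lam : ℂ} (hlam : lam ≠ 0) {M : ℝ} {N : ℕ}
    {l l' : List ℤ} {n : ℤ} (hl : (cfFrac lam l).2 ≠ 0) (hl' : (cfFrac lam l').2 ≠ 0)
    (hM : cfSq lam l' ≤ M) (hNpos : 0 < N)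
    (hN : prefixBound lam M (cfPair lam l) ≤ N) (hn : (N : ℤ) ≤ |n|) :
    ∃ m : ℤ, |m| ≤ N ∧ cfAbs lam (l ++ n :: l') ≤ cfAbs lam (l ++ m :: l') := by
  by_cases h0 : 0 ∈ l
  · refine ⟨0, by simp, le_of_eq ?_⟩
    rw [cfAbs, cfAbs, cfFrac_append, cfFrac_append, cfTail_eq_of_zero_mem lam h0]
  set w := (cfFrac lam l').1 / (cfFrac lam l').2 with hw
  set m₁ := cfTail lam l (1, 0) with hm₁
  have hm₂ : cfTail lam l (0, 1) = cfFrac lam l := rfl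
  set m₂ := cfFrac lam l with hm₂'
  set a := m₂.1 / m₂.2 with ha
  set b := m₁.1 / (lam * m₂.2) with hb
  set q := m₁.2 / (lam * m₂.2) with hq
  have hfrac {x : ℤ} (hx : x ≠ 0) : cfFrac lam (l ++ x :: l') =
      ((cfFrac lam l').2 * (lam * m₂.2) * (a * (x + w) + b),
        (cfFrac lam l').2 * (lam * m₂.2) * (x + w + q)) := by
    rw [cfFrac_append, cfFrac_cons_of_ne lam hx, cfTail_eq_linear lam h0, hm₂, ← hm₁]
    ext
    · simp [ha, hb, hw]
      field_simp
      ring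
    · simp [hq, hw]
      field_simp
      ring
  have hval {x : ℤ} (hx : x ≠ 0) (hx' : x + w + q ≠ 0) :
      cfAbs lam (l ++ x :: l') = ‖(a * (x + w) + b) / (x + w + q)‖ₑ := by
    have h : (cfFrac lam l').2 * (lam * m₂.2) ≠ 0 := mul_ne_zero hl' (mul_ne_zero hlam hl)
    rw [cfAbs_of_ne_zero, hfrac hx]
    · rw [mul_div_mul_left _ _ h]
    · rw [hfrac hx]
      exact mul_ne_zero h hx'
  have hNn : (N : ℝ) ≤ |(n : ℝ)| := by exact_mod_cast hn
  have hn0 : n ≠ 0 := by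
    rintro rfl
    simp at hn
    omega
  obtain ⟨h1, x, hx, h2, h3⟩ := moebius_le_max hM hN hNn
  rw [Complex.ofReal_intCast] at h1 h3
  obtain ⟨y, hy, hyx⟩ : ∃ y : ℤ, |y| = N ∧ (y : ℝ) = x := by
    rcases hx with rfl | rfl
    · exact ⟨N, by simp, by simp⟩
    · exact ⟨-N, by simp, by simp⟩
  have hy0 : y ≠ 0 := by
    rintro rfl
    simp at hy
    omega
  rw [← hyx, Complex.ofReal_intCast] at h2 h3
  rcases le_max_iff.1 h3 with h | h
  · refine ⟨0, by simp, ?_⟩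
    have hz : cfFrac lam (l ++ 0 :: l') = m₂ := by
      rw [cfFrac_append, cfFrac_zero_cons, hm₂]
    rw [hval hn0 h1, cfAbs_of_ne_zero (by rwa [hz]), hz]
    exact enorm_le_enorm_of_normSq_le h
  · refine ⟨y, hy.le, ?_⟩
    rw [hval hn0 h1, hval hy0 h2]
    exact enorm_le_enorm_of_normSq_le h

/-- If `N 0 ≤ N 1 ≤ ⋯` is such that `N (j + 1)` is at least the bound of each prefix of length `j`
with entries up to `N j`, then the box of size `N k` contains a maximal continued fraction with `k`
entries. -/
theorem exists_mem_cfBox_cfAbs_le {lam : ℂ} (hlam : lam ≠ 0) {M : ℝ} {k : ℕ}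
    (hreg : CfRegular lam k)
    (hM : ∀ l : List ℤ, l.length < k → cfSq lam l ≤ M)
    {N : ℕ → ℕ} (hpos : 0 < N 0) (hmono : Monotone N)
    (hN : ∀ j < k, ∀ l ∈ cfBox j (N j), prefixBound lam M (cfPair lam l) ≤ N (j + 1))
    {l : List ℤ} (hl : l.length = k) :
    ∃ l' ∈ cfBox k (N k), cfAbs lam l ≤ cfAbs lam l' := by
  suffices h : ∀ j ≤ k, ∃ l₁ l₂ : List ℤ, l₁ ∈ cfBox j (N j) ∧ j + l₂.length = k ∧
      cfAbs lam l ≤ cfAbs lam (l₁ ++ l₂) by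
    obtain ⟨l₁, l₂, h1, h2, h3⟩ := h k le_rfl
    have : l₂ = [] := by
      rw [← List.length_eq_zero_iff]
      omega
    subst this
    exact ⟨l₁, h1, by simpa using h3⟩
  intro j
  induction j with
  | zero => exact fun _ => ⟨[], l, by simp [cfBox], by simpa using hl, le_rfl⟩
  | succ j ih =>
    intro hj
    obtain ⟨l₁, l₂, h1, h2, h3⟩ := ih (by omega)
    obtain _ | ⟨n, l₂⟩ := l₂
    · simp at h2
      omega
    rw [List.length_cons] at h2
    have hNj : (N j : ℤ) ≤ N (j + 1) := by exact_mod_cast hmono (Nat.le_succ j)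
    have hbox {m : ℤ} (hm : |m| ≤ N (j + 1)) : l₁ ++ [m] ∈ cfBox (j + 1) (N (j + 1)) := by
      refine ⟨by simp [h1.1], fun x hx => ?_⟩
      rcases List.mem_append.1 hx with h | h
      · exact (h1.2 x h).trans hNj
      · rw [List.mem_singleton.1 h]
        exact hm
    by_cases hn : |n| ≤ N (j + 1)
    · exact ⟨l₁ ++ [n], l₂, hbox hn, by omega, by simpa using h3⟩
    · have hlen : l₁.length = j := h1.1
      obtain ⟨m, hm, hle⟩ := exists_cfAbs_le_of_prefixBound_le hlam (n := n)
        (hreg l₁ (by omega)) (hreg l₂ (by omega)) (hM l₂ (by omega))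
        (hpos.trans_le (hmono (Nat.zero_le (j + 1)))) (hN j (by omega) l₁ h1) (by omega)
      exact ⟨l₁ ++ [m], l₂, hbox hm, by omega, by simpa using h3.trans hle⟩

/-! ### Computable functions on coded data -/

namespace RealProgram

theorem Runs.of_eq {p : RealProgram} {v w w' : List ℝ} (h : Runs p v w) (e : w = w') :
    Runs p v w' := e ▸ h

theorem Runs.while_exit {c f : RealProgram} {v b : List ℝ} (hc : Runs c v b)
    (hb : ¬ 0 < b.getD 0 0) : Runs (.whilePos c f) v v := by
  constructor
  exacts [hc, hb]

/-- On a memory that consists of the length of a list `a`, the list `a` and a list `b`, this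
program returns `b`. -/
def dropBlock : RealProgram :=
  .comp .tail (.whilePos .head (.append (.comp .sub (.append .head .one)) (.comp .tail .tail)))

theorem runs_dropBlock (a b : List ℝ) : Runs dropBlock ((a.length : ℝ) :: (a ++ b)) b := by
  refine .comp (a := 0 :: b) ?_ (.tail _)
  induction a with
  | nil => exact .of_eq (.while_exit (.head _) (by simp)) (by simp)
  | cons x a ih =>
    refine .while_step (.head _) (by simp; positivity) (.append (.comp (.append (.head _) (.one _))
      (.sub _)) (.comp (.tail _) (.tail _))) ?_
    simpa using ih

/-- Moves the first block of the memory behind the second one, with length entry `0`. -/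
def rotateBlock : RealProgram :=
  .whilePos .head (.append (.append (.comp .sub (.append .head .one)) (.comp .tail .tail))
    (.comp .head .tail))

theorem runs_rotateBlock (a b : List ℝ) :
    Runs rotateBlock ((a.length : ℝ) :: (a ++ b)) (0 :: (b ++ a)) := by
  induction a generalizing b with
  | nil => exact .of_eq (.while_exit (.head _) (by simp)) (by simp)
  | cons x a ih =>
    refine .while_step (.head _) (by simp; positivity) (.append (.append (.comp (.append (.head _)
      (.one _)) (.sub _)) (.comp (.tail _) (.tail _))) (.comp (.tail _) (.head _))) ?_
    simpa [rotateBlock] using ih (b ++ [x])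

/-- Exchanges the two blocks of the memory. -/
def swapBlocks : RealProgram :=
  .append (.comp .sub (.append (.comp .sub (.append .len .one)) .head)) (.comp .tail rotateBlock)

theorem runs_swapBlocks (a b : List ℝ) :
    Runs swapBlocks ((a.length : ℝ) :: (a ++ b)) ((b.length : ℝ) :: (b ++ a)) := by
  refine .of_eq (.append (.comp (.append (.comp (.append (.len _) (.one _)) (.sub _)) (.head _))
    (.sub _)) (.comp (runs_rotateBlock a b) (.tail _))) ?_
  simp

end RealProgram

/-- A representation of the elements of a type by lists of real numbers. It need not be
injective: a function is computable if it is induced by a program on representations. -/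
class RealCode (α : Type*) where
  /-- The list of real numbers that represents an element. -/
  code : α → List ℝ

namespace RealCode

instance : RealCode ℝ := ⟨fun x => [x]⟩

instance : RealCode ℕ := ⟨fun n => [(n : ℝ)]⟩

instance {α β : Type*} [RealCode α] [RealCode β] : RealCode (α × β) :=
  ⟨fun p => ((code p.1).length : ℝ) :: (code p.1 ++ code p.2)⟩

instance : RealCode ℂ := ⟨fun z => code (z.re, z.im)⟩

/-- The code of a list is the sequence of the codes of its entries, each one preceded by its
length. -/
def listCode {α : Type*} [RealCode α] : List α → List ℝ
  | [] => []
  | a :: l => ((code a).length : ℝ) :: (code a ++ listCode l)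

instance {α : Type*} [RealCode α] : RealCode (List α) := ⟨listCode⟩

theorem listCode_append {α : Type*} [RealCode α] (l l' : List α) :
    listCode (l ++ l') = listCode l ++ listCode l' := by
  induction l with
  | nil => rfl
  | cons a l ih => simp [listCode, ih]

end RealCode

/-- A list of real numbers that is represented by itself, without the lengths of its entries. -/
structure RealMemory where
  /-- The underlying list. -/
  entries : List ℝ

instance : RealCode RealMemory := ⟨RealMemory.entries⟩

section

open RealCode RealProgram

/-- A function is computable if some program computes it on representations. -/
def RealComputable {α β : Type*} [RealCode α] [RealCode β] (f : α → β) : Prop :=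
  ∃ p : RealProgram, ∀ a, p.Runs (code a) (code (f a))

namespace RealComputable

variable {α β γ σ : Type*} [RealCode α] [RealCode β] [RealCode γ] [RealCode σ]

theorem of_eq {f g : α → β} (hf : RealComputable f) (h : ∀ a, f a = g a) : RealComputable g :=
  (funext h : f = g) ▸ hf

protected theorem id : RealComputable fun a : α => a := ⟨.id, fun _ => .id _⟩

theorem comp {g : β → γ} {f : α → β} (hg : RealComputable g) (hf : RealComputable f) :
    RealComputable fun a => g (f a) := by
  obtain ⟨p, hp⟩ := hg
  obtain ⟨q, hq⟩ := hf
  exact ⟨.comp p q, fun a => .comp (hq a) (hp _)⟩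

theorem fst : RealComputable fun p : α × β => p.1 :=
  ⟨.comp dropBlock swapBlocks, fun _ => .comp (runs_swapBlocks _ _) (runs_dropBlock _ _)⟩

theorem snd : RealComputable fun p : α × β => p.2 :=
  ⟨dropBlock, fun _ => runs_dropBlock _ _⟩

theorem fst' {f : γ → α × β} (hf : RealComputable f) : RealComputable fun c => (f c).1 :=
  fst.comp hf

theorem snd' {f : γ → α × β} (hf : RealComputable f) : RealComputable fun c => (f c).2 :=
  snd.comp hf

theorem pair {f : γ → α} {g : γ → β} (hf : RealComputable f) (hg : RealComputable g) :
    RealComputable fun c => (f c, g c) := by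
  obtain ⟨p, hp⟩ := hf
  obtain ⟨q, hq⟩ := hg
  exact ⟨.append (.comp .len p) (.append p q),
    fun c => .append (.comp (hp c) (.len _)) (.append (hp c) (hq c))⟩

/-- Case distinction by the sign of a real number. -/
theorem ite_pos {c : α → ℝ} {f g : α → β} (hc : RealComputable c) (hf : RealComputable f)
    (hg : RealComputable g) : RealComputable fun a => if 0 < c a then f a else g a := by
  obtain ⟨p, hp⟩ := hc
  obtain ⟨q, hq⟩ := hf
  obtain ⟨r, hr⟩ := hg
  refine ⟨.ifPos p q r, fun a => ?_⟩
  by_cases h : 0 < c a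
  · simp only [if_pos h]
    exact .ifPos_true (hp a) h (hq a)
  · simp only [if_neg h]
    exact .ifPos_false (hp a) h (hr a)

/-- A loop, whose result is described by the number `n` of its iterations. -/
theorem while_pos {c : σ → ℝ} {f r : σ → σ} (hc : RealComputable c) (hf : RealComputable f)
    (h : ∀ s, ∃ n, r s = f^[n] s ∧ ¬ 0 < c (f^[n] s) ∧ ∀ m < n, 0 < c (f^[m] s)) :
    RealComputable r := by
  obtain ⟨p, hp⟩ := hc
  obtain ⟨q, hq⟩ := hf
  refine ⟨.whilePos p q, fun s => ?_⟩
  obtain ⟨n, hr, hn, hm⟩ := h s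
  rw [hr]
  clear hr
  induction n generalizing s with
  | zero => exact .while_exit (hp s) hn
  | succ n ih =>
    exact .while_step (hp s) (hm 0 (Nat.succ_pos n)) (hq s)
      (ih (f s) hn fun m hmn => hm (m + 1) (by omega))

/-! ### Arithmetic -/

theorem real_zero : RealComputable fun _ : α => (0 : ℝ) := ⟨.zero, fun _ => .zero _⟩

theorem real_one : RealComputable fun _ : α => (1 : ℝ) := ⟨.one, fun _ => .one _⟩

theorem add {f g : α → ℝ} (hf : RealComputable f) (hg : RealComputable g) :
    RealComputable fun a => f a + g a := by
  obtain ⟨p, hp⟩ := hf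
  obtain ⟨q, hq⟩ := hg
  exact ⟨.comp .add (.append p q), fun a => .comp (.append (hp a) (hq a)) (.add _)⟩

theorem sub {f g : α → ℝ} (hf : RealComputable f) (hg : RealComputable g) :
    RealComputable fun a => f a - g a := by
  obtain ⟨p, hp⟩ := hf
  obtain ⟨q, hq⟩ := hg
  exact ⟨.comp .sub (.append p q), fun a => .comp (.append (hp a) (hq a)) (.sub _)⟩

theorem mul {f g : α → ℝ} (hf : RealComputable f) (hg : RealComputable g) :
    RealComputable fun a => f a * g a := by
  obtain ⟨p, hp⟩ := hf
  obtain ⟨q, hq⟩ := hg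
  exact ⟨.comp .mul (.append p q), fun a => .comp (.append (hp a) (hq a)) (.mul _)⟩

theorem div {f g : α → ℝ} (hf : RealComputable f) (hg : RealComputable g) :
    RealComputable fun a => f a / g a := by
  obtain ⟨p, hp⟩ := hf
  obtain ⟨q, hq⟩ := hg
  exact ⟨.comp .div (.append p q), fun a => .comp (.append (hp a) (hq a)) (.div _)⟩

theorem natCast {f : α → ℕ} (hf : RealComputable f) : RealComputable fun a => (f a : ℝ) := hf

theorem of_natCast {f : α → ℕ} (hf : RealComputable fun a => (f a : ℝ)) : RealComputable f := hf

theorem nat_const (n : ℕ) : RealComputable fun _ : α => n := by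
  induction n with
  | zero => exact of_natCast (real_zero.of_eq fun _ => by simp)
  | succ n ih => exact of_natCast ((ih.natCast.add real_one).of_eq fun _ => by push_cast; rfl)

theorem real_ofNat (n : ℕ) [n.AtLeastTwo] : RealComputable fun _ : α => (OfNat.ofNat n : ℝ) :=
  (nat_const n).natCast

theorem nat_add {f g : α → ℕ} (hf : RealComputable f) (hg : RealComputable g) :
    RealComputable fun a => f a + g a :=
  of_natCast ((hf.natCast.add hg.natCast).of_eq fun _ => by push_cast; rfl)

theorem nat_pred {f : α → ℕ} (hf : RealComputable f) : RealComputable fun a => f a - 1 := by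
  refine of_natCast ((hf.natCast.ite_pos (hf.natCast.sub real_one) real_zero).of_eq fun a => ?_)
  rcases Nat.eq_zero_or_pos (f a) with h | h
  · simp [h]
  · rw [if_pos (by exact_mod_cast h), Nat.cast_sub h, Nat.cast_one]

theorem complex_mk {f g : α → ℝ} (hf : RealComputable f) (hg : RealComputable g) :
    RealComputable fun a => (⟨f a, g a⟩ : ℂ) := hf.pair hg

theorem re {f : α → ℂ} (hf : RealComputable f) : RealComputable fun a => (f a).re :=
  fst' (f := fun a => ((f a).re, (f a).im)) hf

theorem im {f : α → ℂ} (hf : RealComputable f) : RealComputable fun a => (f a).im :=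
  snd' (f := fun a => ((f a).re, (f a).im)) hf

theorem ofReal {f : α → ℝ} (hf : RealComputable f) : RealComputable fun a => (f a : ℂ) :=
  complex_mk hf real_zero

theorem complex_add {f g : α → ℂ} (hf : RealComputable f) (hg : RealComputable g) :
    RealComputable fun a => f a + g a :=
  complex_mk (hf.re.add hg.re) (hf.im.add hg.im)

theorem complex_sub {f g : α → ℂ} (hf : RealComputable f) (hg : RealComputable g) :
    RealComputable fun a => f a - g a :=
  complex_mk (hf.re.sub hg.re) (hf.im.sub hg.im)

theorem complex_mul {f g : α → ℂ} (hf : RealComputable f) (hg : RealComputable g) :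
    RealComputable fun a => f a * g a :=
  (complex_mk ((hf.re.mul hg.re).sub (hf.im.mul hg.im))
    ((hf.re.mul hg.im).add (hf.im.mul hg.re))).of_eq fun _ => by apply Complex.ext <;> simp

theorem conj {f : α → ℂ} (hf : RealComputable f) :
    RealComputable fun a => starRingEnd ℂ (f a) :=
  (complex_mk hf.re (real_zero.sub hf.im)).of_eq fun _ => by apply Complex.ext <;> simp

theorem normSq {f : α → ℂ} (hf : RealComputable f) :
    RealComputable fun a => Complex.normSq (f a) :=
  ((hf.re.mul hf.re).add (hf.im.mul hf.im)).of_eq fun _ => (Complex.normSq_apply _).symm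

theorem complex_div {f g : α → ℂ} (hf : RealComputable f) (hg : RealComputable g) :
    RealComputable fun a => f a / g a :=
  (complex_mk (((hf.re.mul hg.re).div hg.normSq).add ((hf.im.mul hg.im).div hg.normSq))
    (((hf.im.mul hg.re).div hg.normSq).sub ((hf.re.mul hg.im).div hg.normSq))).of_eq fun _ =>
    Complex.ext (Complex.div_re _ _).symm (Complex.div_im _ _).symm

theorem real_max {f g : α → ℝ} (hf : RealComputable f) (hg : RealComputable g) :
    RealComputable fun a => max (f a) (g a) :=
  ((hg.sub hf).ite_pos hg hf).of_eq fun a => by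
    split_ifs with h
    · rw [max_eq_right (sub_pos.1 h).le]
    · rw [max_eq_left (not_lt.1 (mt sub_pos.2 h))]

/-! ### Recursion -/

/-- The least natural number above a real number is found by counting. -/
theorem natCeil {f : α → ℝ} (hf : RealComputable f) : RealComputable fun a => ⌈f a⌉₊ := by
  have hloop : RealComputable fun s : ℝ × ℕ => (s.1, max s.2 ⌈s.1⌉₊) := by
    refine while_pos (c := fun s : ℝ × ℕ => s.1 - s.2) (f := fun s => (s.1, s.2 + 1))
      (fst.sub snd.natCast) (fst.pair (snd.nat_add (nat_const 1))) fun s => ?_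
    have hiter (m : ℕ) : (fun s : ℝ × ℕ => (s.1, s.2 + 1))^[m] s = (s.1, s.2 + m) := by
      induction m with
      | zero => rfl
      | succ m ih => rw [Function.iterate_succ_apply', ih, add_assoc]
    refine ⟨⌈s.1⌉₊ - s.2, ?_, ?_, fun m hm => ?_⟩
    · rw [hiter]
      ext
      · rfl
      · simp only
        omega
    · rw [hiter, sub_pos, ← Nat.lt_ceil]
      simp only
      omega
    · rw [hiter, sub_pos, ← Nat.lt_ceil]
      simp only
      omega
  exact ((hloop.comp (hf.pair (nat_const 0))).snd').of_eq fun a => by simp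

theorem iterate {n : γ → ℕ} {g : γ → σ} {h : γ → σ → σ} (hn : RealComputable n)
    (hg : RealComputable g) (hh : RealComputable fun p : γ × σ => h p.1 p.2) :
    RealComputable fun c => (h c)^[n c] (g c) := by
  have hloop : RealComputable fun s : ℕ × γ × σ => (0, s.2.1, (h s.2.1)^[s.1] s.2.2) := by
    refine while_pos (c := fun s : ℕ × γ × σ => (s.1 : ℝ))
      (f := fun s => (s.1 - 1, s.2.1, h s.2.1 s.2.2)) fst.natCast
      (fst.nat_pred.pair (snd.fst'.pair (hh.comp snd))) fun s => ?_
    have hiter (m : ℕ) : (fun s : ℕ × γ × σ => (s.1 - 1, s.2.1, h s.2.1 s.2.2))^[m] s =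
        (s.1 - m, s.2.1, (h s.2.1)^[m] s.2.2) := by
      induction m with
      | zero => rfl
      | succ m ih =>
        rw [Function.iterate_succ_apply', ih, Function.iterate_succ_apply', Nat.sub_sub]
    refine ⟨s.1, ?_, ?_, fun m hm => ?_⟩
    · rw [hiter, Nat.sub_self]
    · simp [hiter]
    · rw [hiter]
      simpa using hm
  exact (hloop.comp (hn.pair (RealComputable.id.pair hg))).snd'.snd'

theorem nat_rec {n : γ → ℕ} {g : γ → σ} {h : γ → ℕ → σ → σ} (hn : RealComputable n)
    (hg : RealComputable g) (hh : RealComputable fun p : γ × ℕ × σ => h p.1 p.2.1 p.2.2) :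
    RealComputable fun c => (Nat.rec (g c) (h c) (n c) : σ) := by
  have h1 : RealComputable fun c => (fun s : ℕ × σ => (s.1 + 1, h c s.1 s.2))^[n c] (0, g c) :=
    iterate (h := fun c (s : ℕ × σ) => (s.1 + 1, h c s.1 s.2)) hn ((nat_const 0).pair hg)
      ((snd.fst'.nat_add (nat_const 1)).pair hh)
  refine h1.snd'.of_eq fun c => ?_
  suffices hrec : ∀ m, (fun s : ℕ × σ => (s.1 + 1, h c s.1 s.2))^[m] (0, g c) =
      (m, (Nat.rec (g c) (h c) m : σ)) by rw [hrec]
  intro m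
  induction m with
  | zero => rfl
  | succ m ih => rw [Function.iterate_succ_apply', ih]

theorem list_nil : RealComputable fun _ : α => ([] : List β) := ⟨.nil, fun _ => .nil _⟩

theorem list_cons {f : α → β} {g : α → List β} (hf : RealComputable f) (hg : RealComputable g) :
    RealComputable fun a => f a :: g a := hf.pair hg

theorem list_append {f g : α → List β} (hf : RealComputable f) (hg : RealComputable g) :
    RealComputable fun a => f a ++ g a := by
  obtain ⟨p, hp⟩ := hf
  obtain ⟨q, hq⟩ := hg
  exact ⟨.append p q, fun a => .of_eq (.append (hp a) (hq a)) (listCode_append _ _).symm⟩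

theorem list_foldl {f : γ → List α} {g : γ → σ} {h : γ → σ → α → σ} (hf : RealComputable f)
    (hg : RealComputable g) (hh : RealComputable fun p : γ × σ × α => h p.1 p.2.1 p.2.2) :
    RealComputable fun c => (f c).foldl (h c) (g c) := by
  have hloop : RealComputable fun s : (γ × σ) × List α =>
      ((s.1.1, s.2.foldl (h s.1.1) s.1.2), ([] : List α)) := by
    obtain ⟨q, hq⟩ : RealComputable fun s : (γ × σ) × α × List α =>
        ((s.1.1, h s.1.1 s.1.2 s.2.1), s.2.2) :=
      (fst.fst'.pair (hh.comp (fst.fst'.pair (fst.snd'.pair snd.fst')))).pair snd.snd'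
    refine ⟨.whilePos (.comp .len dropBlock) q, ?_⟩
    rintro ⟨⟨c, s⟩, l⟩
    induction l generalizing s with
    | nil => exact .while_exit (.comp (runs_dropBlock _ _) (.len _)) (by simp [code, listCode])
    | cons a l ih =>
      refine .while_step (.comp (runs_dropBlock _ _) (.len _)) ?_ (hq ((c, s), (a, l))) (ih _)
      simp only [code, listCode, List.getD_cons_zero, List.length_cons]
      positivity
  exact (hloop.comp ((RealComputable.id.pair hg).pair hf)).fst'.snd'

theorem list_flatMap {f : γ → List α} {g : γ → α → List β} (hf : RealComputable f)
    (hg : RealComputable fun p : γ × α => g p.1 p.2) :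
    RealComputable fun c => (f c).flatMap (g c) := by
  refine (list_foldl (h := fun c acc a => acc ++ g c a) hf (list_nil (β := β))
    (snd.fst'.list_append (hg.comp (fst.pair snd.snd')))).of_eq fun c => ?_
  suffices h : ∀ (l : List α) (acc : List β), l.foldl (fun acc a => acc ++ g c a) acc =
      acc ++ l.flatMap (g c) from (h _ _).trans (List.nil_append _)
  intro l
  induction l with
  | nil => simp
  | cons a l ih => intro acc; simp [ih]

theorem list_map {f : γ → List α} {g : γ → α → β} (hf : RealComputable f)
    (hg : RealComputable fun p : γ × α => g p.1 p.2) :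
    RealComputable fun c => (f c).map (g c) :=
  (list_flatMap (g := fun c a => [g c a]) hf (hg.list_cons list_nil)).of_eq fun _ =>
    List.map_eq_flatMap.symm

theorem list_range {f : γ → ℕ} (hf : RealComputable f) :
    RealComputable fun c => List.range (f c) := by
  refine (nat_rec (h := fun _ n l => l ++ [n]) hf (list_nil (β := ℕ))
    (snd.snd'.list_append (snd.fst'.list_cons list_nil))).of_eq fun c => ?_
  induction f c with
  | zero => rfl
  | succ n ih => rw [List.range_succ, ← ih]

end RealComputable

end

/-! ### The algorithm -/

/-- The integers of absolute value at most `N`. -/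
def cfInterval (N : ℕ) : List ℝ := (List.range (N + N + 1)).map fun m : ℕ => (m : ℝ) - (N : ℝ)

/-- The pairs of continued fractions of all integer lists of length `k` in the box of size `N`. -/
noncomputable def cfPairs (lam : ℂ) (N k : ℕ) : List ((ℂ × ℂ) × (ℂ × ℂ)) :=
  Nat.rec [((1, 0), (0, 1))] (fun _ L => L.flatMap fun s =>
    (cfInterval N).map fun x => (cfStep lam x s.1, cfStep lam x s.2)) k

/-- The maximum of `0` and the values of `f` on a list. -/
noncomputable def listMax {α : Type*} (f : α → ℝ) (l : List α) : ℝ :=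
  l.foldl (fun m a => max m (f a)) 0

/-- Sizes of boxes as in `exists_mem_cfBox_cfAbs_le`. -/
noncomputable def cfLevel (lam : ℂ) (M : ℝ) (k : ℕ) : ℕ :=
  Nat.rec 1 (fun j N => N + ⌈listMax (prefixBound lam M) (cfPairs lam N j)⌉₊) k

/-- Indicates whether the second continued fraction of a pair is infinite. -/
noncomputable def cfPole (s : (ℂ × ℂ) × (ℂ × ℂ)) : ℝ := if 0 < Complex.normSq s.2.2 then 0 else 1

/-- The squared absolute value of the second continued fraction of a pair, if it is finite. -/
noncomputable def cfAbsSq (s : (ℂ × ℂ) × (ℂ × ℂ)) : ℝ := Complex.normSq (s.2.1 / s.2.2)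

/-- The search through the box of size `N`. The result consists of `N`, an indicator of an infinite
maximum, and the square of the maximum if that is finite. -/
noncomputable def cfSearch (lam : ℂ) (N k : ℕ) : ℕ × ℝ × ℝ :=
  if 0 < listMax cfPole (cfPairs lam N k) then (N, 1, 0)
  else (N, 0, listMax cfAbsSq (cfPairs lam N k))

/-- The outcome for continued fractions with `k` entries. It uses that for fewer entries, whose
maximum bounds the tails. Once the maximum is infinite, nothing is left to be searched. -/
noncomputable def cfData (lam : ℂ) (k : ℕ) : ℕ × ℝ × ℝ :=
  Nat.rec (1, 0, 0) (fun j d => if 0 < d.2.1 then (0, 1, 0)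
    else cfSearch lam (cfLevel lam d.2.2 (j + 1)) (j + 1)) k

/-- The output of the algorithm. The indicator of an infinite maximum increases to `1` at the
minimal `u`-degree; for `k = 0` the truncated `k - 1` gives the correct verdict `0`. -/
noncomputable def cfOutput (lam : ℂ) (k : ℕ) : List ℝ :=
  ((cfData lam k).2.1 - (cfData lam (k - 1)).2.1) :: (List.range (k + 1)).flatMap fun i =>
    [((cfData lam i).1 : ℝ), (cfData lam i).2.1, (cfData lam i).2.2]

/-! ### Computability of the algorithm -/

namespace RealComputable

variable {α γ : Type*} [RealCode α] [RealCode γ]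

theorem memory_nil : RealComputable fun _ : α => (⟨[]⟩ : RealMemory) := ⟨.nil, fun _ => .nil _⟩

theorem memory_singleton {f : α → ℝ} (hf : RealComputable f) :
    RealComputable fun a => (⟨[f a]⟩ : RealMemory) := hf

theorem memory_append {f g : α → RealMemory} (hf : RealComputable f) (hg : RealComputable g) :
    RealComputable fun a => (⟨(f a).entries ++ (g a).entries⟩ : RealMemory) := by
  obtain ⟨p, hp⟩ := hf
  obtain ⟨q, hq⟩ := hg
  exact ⟨.append p q, fun a => .append (hp a) (hq a)⟩

theorem complex_zero : RealComputable fun _ : α => (0 : ℂ) :=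
  real_zero.ofReal.of_eq fun _ => Complex.ofReal_zero

theorem complex_one : RealComputable fun _ : α => (1 : ℂ) :=
  real_one.ofReal.of_eq fun _ => Complex.ofReal_one

theorem cfStep {lam : α → ℂ} {x : α → ℝ} {v : α → ℂ × ℂ} (hlam : RealComputable lam)
    (hx : RealComputable x) (hv : RealComputable v) :
    RealComputable fun a => cfStep (lam a) (x a) (v a) := by
  refine ((hx.mul hx).ite_pos (hv.snd'.pair (hlam.complex_mul
    ((hx.ofReal.complex_mul hv.snd').complex_add hv.fst')))
    (complex_zero.pair complex_one)).of_eq fun a => ?_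
  by_cases h : x a = 0
  · simp [_root_.cfStep, h]
  · rw [if_pos (mul_self_pos.2 h), _root_.cfStep, if_neg h]

theorem moebiusBound {M : α → ℝ} {a b q : α → ℂ} (hM : RealComputable M) (ha : RealComputable a)
    (hb : RealComputable b) (hq : RealComputable q) :
    RealComputable fun c => moebiusBound (M c) (a c) (b c) (q c) := by
  have hA := (ha.conj.complex_mul (hb.complex_sub (ha.complex_mul hq))).re
  refine ((real_one.add ((real_ofNat 8).mul (hM.add hq.normSq))).add
    (((real_ofNat 4).mul (((((real_ofNat 4).mul ha.normSq).mul hM).add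
      ((real_ofNat 2).mul hb.normSq)).add (((real_ofNat 2).mul ha.normSq).mul hq.normSq))).mul
      (real_one.add (real_one.div (hA.mul hA))))).of_eq fun c => ?_
  simp only [_root_.moebiusBound, pow_two]

theorem prefixBound {lam : α → ℂ} {M : α → ℝ} {s : α → (ℂ × ℂ) × (ℂ × ℂ)}
    (hlam : RealComputable lam) (hM : RealComputable M) (hs : RealComputable s) :
    RealComputable fun a => prefixBound (lam a) (M a) (s a) :=
  moebiusBound hM (hs.snd'.fst'.complex_div hs.snd'.snd')
    (hs.fst'.fst'.complex_div (hlam.complex_mul hs.snd'.snd'))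
    (hs.fst'.snd'.complex_div (hlam.complex_mul hs.snd'.snd'))

theorem cfInterval {N : α → ℕ} (hN : RealComputable N) :
    RealComputable fun a => cfInterval (N a) :=
  list_map (g := fun a (m : ℕ) => (m : ℝ) - (N a : ℝ))
    (list_range ((hN.nat_add hN).nat_add (nat_const 1)))
    (snd.natCast.sub (hN.comp fst).natCast)

theorem cfPairs {lam : α → ℂ} {N k : α → ℕ} (hlam : RealComputable lam) (hN : RealComputable N)
    (hk : RealComputable k) : RealComputable fun a => cfPairs (lam a) (N a) (k a) := by
  refine nat_rec (h := fun a _ L => L.flatMap fun s => (_root_.cfInterval (N a)).map fun x =>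
      (_root_.cfStep (lam a) x s.1, _root_.cfStep (lam a) x s.2)) hk
    (((complex_one.pair complex_zero).pair (complex_zero.pair complex_one)).list_cons list_nil) ?_
  refine list_flatMap (g := fun (p : α × ℕ × List ((ℂ × ℂ) × (ℂ × ℂ))) s =>
      (_root_.cfInterval (N p.1)).map fun x =>
        (_root_.cfStep (lam p.1) x s.1, _root_.cfStep (lam p.1) x s.2)) snd.snd' ?_
  refine list_map (g := fun (p : (α × ℕ × List ((ℂ × ℂ) × (ℂ × ℂ))) × (ℂ × ℂ) × (ℂ × ℂ)) x =>
      (_root_.cfStep (lam p.1.1) x p.2.1, _root_.cfStep (lam p.1.1) x p.2.2))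
    (cfInterval (hN.comp fst.fst')) ?_
  exact (cfStep (hlam.comp fst.fst'.fst') snd fst.snd'.fst').pair
    (cfStep (hlam.comp fst.fst'.fst') snd fst.snd'.snd')

theorem listMax {f : γ → α → ℝ} {l : γ → List α} (hf : RealComputable fun p : γ × α => f p.1 p.2)
    (hl : RealComputable l) : RealComputable fun c => listMax (f c) (l c) :=
  list_foldl (h := fun c m a => max m (f c a)) hl real_zero
    (snd.fst'.real_max (hf.comp (fst.pair snd.snd')))

theorem cfLevel {lam : α → ℂ} {M : α → ℝ} {k : α → ℕ} (hlam : RealComputable lam)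
    (hM : RealComputable M) (hk : RealComputable k) :
    RealComputable fun a => cfLevel (lam a) (M a) (k a) := by
  refine nat_rec (h := fun a j N => N + ⌈_root_.listMax (_root_.prefixBound (lam a) (M a))
    (_root_.cfPairs (lam a) N j)⌉₊) hk (nat_const 1) ?_
  refine snd.snd'.nat_add (natCeil ?_)
  exact listMax (f := fun (p : α × ℕ × ℕ) s => _root_.prefixBound (lam p.1) (M p.1) s)
    (prefixBound (hlam.comp fst.fst') (hM.comp fst.fst') snd)
    (cfPairs (hlam.comp fst) snd.snd' snd.fst')

theorem cfSearch {lam : α → ℂ} {N k : α → ℕ} (hlam : RealComputable lam) (hN : RealComputable N)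
    (hk : RealComputable k) : RealComputable fun a => cfSearch (lam a) (N a) (k a) := by
  have hpole : RealComputable cfPole :=
    ite_pos (c := fun s : (ℂ × ℂ) × (ℂ × ℂ) => Complex.normSq s.2.2) snd.snd'.normSq real_zero
      real_one
  have habs : RealComputable cfAbsSq := (snd.fst'.complex_div snd.snd').normSq
  have hpairs := cfPairs hlam hN hk
  exact ite_pos (listMax (f := fun _ => cfPole) (hpole.comp snd) hpairs)
    (hN.pair (real_one.pair real_zero))
    (hN.pair (real_zero.pair (listMax (f := fun _ => cfAbsSq) (habs.comp snd) hpairs)))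

theorem cfData {lam : α → ℂ} {k : α → ℕ} (hlam : RealComputable lam) (hk : RealComputable k) :
    RealComputable fun a => cfData (lam a) (k a) := by
  refine nat_rec (h := fun a j (d : ℕ × ℝ × ℝ) => if 0 < d.2.1 then (0, 1, 0)
    else _root_.cfSearch (lam a) (_root_.cfLevel (lam a) d.2.2 (j + 1)) (j + 1)) hk
    ((nat_const 1).pair (real_zero.pair real_zero)) ?_
  have hj : RealComputable fun p : α × ℕ × ℕ × ℝ × ℝ => p.2.1 + 1 :=
    snd.fst'.nat_add (nat_const 1)
  exact ite_pos (c := fun p : α × ℕ × ℕ × ℝ × ℝ => p.2.2.2.1) (f := fun _ => (0, 1, 0))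
    (g := fun p => _root_.cfSearch (lam p.1) (_root_.cfLevel (lam p.1) p.2.2.2.2 (p.2.1 + 1))
      (p.2.1 + 1)) snd.snd'.snd'.fst' ((nat_const 0).pair (real_one.pair real_zero))
    (cfSearch (hlam.comp fst) (cfLevel (hlam.comp fst) snd.snd'.snd'.snd' hj) hj)

theorem cfOutput : RealComputable fun p : ℂ × ℕ => (⟨cfOutput p.1 p.2⟩ : RealMemory) := by
  have hd := cfData (fst (α := ℂ) (β := ℕ)) snd
  have hd' := cfData (fst (α := ℂ) (β := ℕ)) snd.nat_pred
  let h (p : ℂ × ℕ) (i : ℕ) (v : RealMemory) : RealMemory :=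
    ⟨v.entries ++ [((_root_.cfData p.1 i).1 : ℝ), (_root_.cfData p.1 i).2.1,
      (_root_.cfData p.1 i).2.2]⟩
  have hh : RealComputable fun p : (ℂ × ℕ) × ℕ × RealMemory => h p.1 p.2.1 p.2.2 := by
    have hdi : RealComputable fun p : (ℂ × ℕ) × ℕ × RealMemory => _root_.cfData p.1.1 p.2.1 :=
      cfData fst.fst' snd.fst'
    exact snd.snd'.memory_append ((memory_singleton hdi.fst'.natCast).memory_append
      ((memory_singleton hdi.snd'.fst').memory_append (memory_singleton hdi.snd'.snd')))
  have hrec := nat_rec (snd.nat_add (nat_const 1)) memory_nil hh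
  refine ((memory_singleton (hd.snd'.fst'.sub hd'.snd'.fst')).memory_append hrec).of_eq fun p => ?_
  rw [_root_.cfOutput]
  congr 1
  rw [List.singleton_append]
  congr 1
  induction p.2 + 1 with
  | zero => rfl
  | succ m ih => rw [List.range_succ, List.flatMap_append, ← ih]; rfl

end RealComputable

/-- A program computes `cfOutput` from the real and imaginary part of `λ` and from `k`. It first
prepends the lengths of the blocks to its input, which yields the code of `(λ, k)`. -/
theorem exists_realProgram_cfOutput : ∃ A : RealProgram, ∀ (lam : ℂ) (k : ℕ),
    A.Runs [lam.re, lam.im, (k : ℝ)] (cfOutput lam k) := by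
  obtain ⟨p, hp⟩ := RealComputable.cfOutput
  refine ⟨.comp p (.append (.comp .add (.append (.comp .add (.append .one .one)) .one))
    (.append .one .id)), fun lam k => .comp (.of_eq (.append (.comp (.append (.comp (.append
      (.one _) (.one _)) (.add _)) (.one _)) (.add _)) (.append (.one _) (.id _))) ?_)
      (hp (lam, k))⟩
  simp [RealCode.code]
  norm_num

/-! ### Correctness of the algorithm -/

theorem le_foldl_max {α : Type*} (f : α → ℝ) (l : List α) (x : ℝ) :
    x ≤ l.foldl (fun m a => max m (f a)) x := by
  induction l generalizing x with
  | nil => exact le_rfl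
  | cons b l ih => exact (le_max_left _ _).trans (ih _)

theorem le_listMax {α : Type*} (f : α → ℝ) {l : List α} {a : α} (ha : a ∈ l) :
    f a ≤ listMax f l := by
  rw [listMax]
  generalize (0 : ℝ) = x
  induction l generalizing x with
  | nil => simp at ha
  | cons b l ih =>
    rcases List.mem_cons.1 ha with rfl | h
    · exact (le_max_right _ _).trans (le_foldl_max f l _)
    · exact ih h _

theorem listMax_eq_zero_or_exists {α : Type*} (f : α → ℝ) (l : List α) :
    listMax f l = 0 ∨ ∃ a ∈ l, f a = listMax f l := by
  rw [listMax]
  generalize (0 : ℝ) = x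
  induction l generalizing x with
  | nil => exact Or.inl rfl
  | cons b l ih =>
    rw [List.foldl_cons]
    rcases ih (max x (f b)) with h | ⟨a, ha, h⟩
    · rcases max_choice x (f b) with h' | h'
      · exact Or.inl (h.trans h')
      · exact Or.inr ⟨b, by simp, (h.trans h').symm⟩
    · exact Or.inr ⟨a, by simp [ha], h⟩

theorem mem_cfInterval {N : ℕ} {x : ℝ} : x ∈ cfInterval N ↔ ∃ n : ℤ, |n| ≤ N ∧ (n : ℝ) = x := by
  simp only [cfInterval, List.mem_map, List.mem_range]
  constructor
  · rintro ⟨m, hm, rfl⟩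
    exact ⟨m - N, by rw [abs_le]; omega, by simp⟩
  · rintro ⟨n, hn, rfl⟩
    rw [abs_le] at hn
    refine ⟨(n + N).toNat, by omega, ?_⟩
    have h : (((n + N).toNat : ℤ) : ℝ) = ((n + N : ℤ) : ℝ) := by
      rw [Int.toNat_of_nonneg (by omega)]
    push_cast at h
    linarith

theorem mem_cfPairs {lam : ℂ} {N k : ℕ} {s : (ℂ × ℂ) × (ℂ × ℂ)} :
    s ∈ cfPairs lam N k ↔ ∃ l ∈ cfBox k N, cfPair lam l = s := by
  induction k generalizing s with
  | zero => simp [cfPairs, cfBox, cfPair, cfTail, eq_comm, List.length_eq_zero_iff, and_assoc]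
  | succ k ih =>
    have hsucc : cfPairs lam N (k + 1) = (cfPairs lam N k).flatMap fun s =>
      (cfInterval N).map fun x => (cfStep lam x s.1, cfStep lam x s.2) := rfl
    simp only [hsucc, List.mem_flatMap, List.mem_map, mem_cfInterval]
    constructor
    · rintro ⟨t, ht, x, ⟨n, hn, rfl⟩, rfl⟩
      obtain ⟨l, hl, rfl⟩ := ih.1 ht
      exact ⟨n :: l, ⟨by simp [hl.1], by simpa using ⟨hn, hl.2⟩⟩, rfl⟩
    · rintro ⟨l, ⟨h1, h2⟩, rfl⟩
      obtain _ | ⟨n, l⟩ := l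
      · simp at h1
      · rw [List.forall_mem_cons] at h2
        exact ⟨cfPair lam l, ih.2 ⟨l, ⟨by simpa using h1, h2.2⟩, rfl⟩, n, ⟨n, h2.1, rfl⟩, rfl⟩

theorem cfFrac_append_replicate_zero (lam : ℂ) (l : List ℤ) (m : ℕ) :
    cfFrac lam (l ++ List.replicate m 0) = cfFrac lam l := by
  rw [cfFrac_append]
  cases m with
  | zero => rfl
  | succ m => rw [List.replicate_succ, cfFrac_zero_cons]; rfl

theorem cfAbs_eq_top_iff {lam : ℂ} {l : List ℤ} : cfAbs lam l = ⊤ ↔ (cfFrac lam l).2 = 0 := by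
  rw [cfAbs]
  split_ifs with h <;> simp [h]

theorem toReal_cfAbs_sq {lam : ℂ} {l : List ℤ} (h : (cfFrac lam l).2 ≠ 0) :
    (cfAbs lam l).toReal ^ 2 = cfSq lam l := by
  rw [cfAbs_of_ne_zero h, toReal_enorm, cfSq, Complex.normSq_eq_norm_sq]

theorem cfAbs_le_cfAbs_iff {lam : ℂ} {l l' : List ℤ} (h : (cfFrac lam l).2 ≠ 0)
    (h' : (cfFrac lam l').2 ≠ 0) : cfAbs lam l ≤ cfAbs lam l' ↔ cfSq lam l ≤ cfSq lam l' := by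
  rw [cfAbs_of_ne_zero h, cfAbs_of_ne_zero h', enorm_le_iff_norm_le, cfSq, cfSq,
    Complex.normSq_eq_norm_sq, Complex.normSq_eq_norm_sq,
    pow_le_pow_iff_left₀ (norm_nonneg _) (norm_nonneg _) two_ne_zero]

theorem cfLevel_succ (lam : ℂ) (M : ℝ) (j : ℕ) : cfLevel lam M (j + 1) =
    cfLevel lam M j + ⌈listMax (prefixBound lam M) (cfPairs lam (cfLevel lam M j) j)⌉₊ := rfl

theorem monotone_cfLevel (lam : ℂ) (M : ℝ) : Monotone (cfLevel lam M) :=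
  monotone_nat_of_le_succ fun j => by rw [cfLevel_succ]; exact Nat.le_add_right _ _

theorem one_le_cfLevel (lam : ℂ) (M : ℝ) (j : ℕ) : 1 ≤ cfLevel lam M j :=
  monotone_cfLevel lam M (Nat.zero_le j)

theorem exists_mem_cfBox_cfLevel {lam : ℂ} (hlam : lam ≠ 0) {M : ℝ} {k : ℕ}
    (hreg : CfRegular lam k) (hM : ∀ l : List ℤ, l.length < k → cfSq lam l ≤ M)
    {l : List ℤ} (hl : l.length = k) :
    ∃ l' ∈ cfBox k (cfLevel lam M k), cfAbs lam l ≤ cfAbs lam l' := by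
  refine exists_mem_cfBox_cfAbs_le hlam hreg hM (one_le_cfLevel lam M 0) (monotone_cfLevel lam M)
    (fun j _ l hl => ?_) hl
  have h := le_listMax (prefixBound lam M) (mem_cfPairs (lam := lam).2 ⟨l, hl, rfl⟩)
  rw [cfLevel_succ, Nat.cast_add]
  exact (h.trans (Nat.le_ceil _)).trans (le_add_of_nonneg_left (Nat.cast_nonneg _))

/-- What `cfData` says about continued fractions with `k` entries. -/
structure CfDataCorrect (lam : ℂ) (k : ℕ) (d : ℕ × ℝ × ℝ) : Prop where
  finite : CfRegular lam (k + 1) → d.2.1 = 0 ∧ (∀ l : List ℤ, l.length = k → cfSq lam l ≤ d.2.2) ∧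
    ∃ l ∈ cfBox k d.1, cfSq lam l = d.2.2
  infinite : ¬ CfRegular lam (k + 1) → d.2.1 = 1 ∧ d.2.2 = 0
  exists_pole : CfRegular lam k → ¬ CfRegular lam (k + 1) →
    ∃ l ∈ cfBox k d.1, (cfFrac lam l).2 = 0

theorem exists_length_eq_of_not_cfRegular_succ {lam : ℂ} {k : ℕ} (h : CfRegular lam k)
    (h' : ¬ CfRegular lam (k + 1)) : ∃ l : List ℤ, l.length = k ∧ (cfFrac lam l).2 = 0 := by
  simp only [CfRegular, not_forall, not_not] at h'
  obtain ⟨l, hl, h0⟩ := h'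
  refine ⟨l, ?_, h0⟩
  by_contra hne
  exact h l (by omega) h0

theorem cfPole_cfPair (lam : ℂ) (l : List ℤ) :
    cfPole (cfPair lam l) = if (cfFrac lam l).2 = 0 then 1 else 0 := by
  change (if 0 < Complex.normSq (cfFrac lam l).2 then (0 : ℝ) else 1) = _
  by_cases h : (cfFrac lam l).2 = 0
  · simp [h]
  · simp [h]

theorem cfSearch_correct {lam : ℂ} {N k : ℕ}
    (hpole : CfRegular lam k → ¬ CfRegular lam (k + 1) →
      ∃ l ∈ cfBox k N, (cfFrac lam l).2 = 0)
    (hbox : CfRegular lam (k + 1) → ∀ l : List ℤ, l.length = k →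
      ∃ l' ∈ cfBox k N, cfSq lam l ≤ cfSq lam l')
    (hreg : CfRegular lam k) : CfDataCorrect lam k (cfSearch lam N k) := by
  by_cases h : CfRegular lam (k + 1)
  · have h0 : ¬ 0 < listMax cfPole (cfPairs lam N k) := by
      rcases listMax_eq_zero_or_exists cfPole (cfPairs lam N k) with h0 | ⟨s, hs, h0⟩
      · rw [h0]
        exact lt_irrefl 0
      · obtain ⟨l, hl, rfl⟩ := mem_cfPairs.1 hs
        rw [← h0, cfPole_cfPair, if_neg (h l (by rw [hl.1]; omega))]
        exact lt_irrefl 0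
    have hle {l : List ℤ} (hl : l ∈ cfBox k N) : cfSq lam l ≤ listMax cfAbsSq (cfPairs lam N k) :=
      le_listMax cfAbsSq (mem_cfPairs.2 ⟨l, hl, rfl⟩)
    rw [cfSearch, if_neg h0]
    refine ⟨fun _ => ⟨rfl, fun l hl => ?_, ?_⟩, fun h' => absurd h h', fun _ h' => absurd h h'⟩
    · obtain ⟨l', hl', hll⟩ := hbox h l hl
      exact hll.trans (hle hl')
    · rcases listMax_eq_zero_or_exists cfAbsSq (cfPairs lam N k) with h0 | ⟨s, hs, h0⟩
      · -- the maximum `0` is attained by the continued fraction `[∞, …, ∞]`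
        have hmem : List.replicate k 0 ∈ cfBox k N :=
          ⟨List.length_replicate, fun n hn => by simp [List.eq_of_mem_replicate hn]⟩
        exact ⟨_, hmem, le_antisymm (hle hmem) (by rw [h0]; exact Complex.normSq_nonneg _)⟩
      · obtain ⟨l, hl, rfl⟩ := mem_cfPairs.1 hs
        exact ⟨l, hl, h0⟩
  · obtain ⟨l, hl, h0⟩ := hpole hreg h
    have hpos : 0 < listMax cfPole (cfPairs lam N k) := by
      refine lt_of_lt_of_le ?_ (le_listMax cfPole (mem_cfPairs.2 ⟨l, hl, rfl⟩))
      rw [cfPole_cfPair, if_pos h0]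
      exact one_pos
    rw [cfSearch, if_pos hpos]
    exact ⟨fun h' => absurd h' h, fun _ => ⟨rfl, rfl⟩, fun _ _ => ⟨l, hl, h0⟩⟩

theorem cfRegular_one (lam : ℂ) : CfRegular lam 1 := fun l hl => by
  obtain rfl : l = [] := by
    rw [← List.length_eq_zero_iff]
    omega
  simp [cfFrac_nil]

/-- For `λ = 0` the continued fraction `[1]` is infinite. -/
theorem cfFrac_zero_singleton : (cfFrac 0 [1]).2 = 0 := by
  simp [cfFrac_cons_of_ne]

theorem cfData_correct (lam : ℂ) (k : ℕ) : CfDataCorrect lam k (cfData lam k) := by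
  induction k with
  | zero =>
    refine ⟨fun _ => ⟨rfl, fun l hl => ?_, [], by simp [cfBox], ?_⟩,
      fun h => absurd (cfRegular_one lam) h, fun _ h => absurd (cfRegular_one lam) h⟩
    · rw [List.length_eq_zero_iff.1 hl]
      simp [cfSq, cfFrac_nil, cfData]
    · simp [cfSq, cfFrac_nil, cfData]
  | succ k ih =>
    have hsucc : cfData lam (k + 1) = if 0 < (cfData lam k).2.1 then (0, 1, 0)
      else cfSearch lam (cfLevel lam (cfData lam k).2.2 (k + 1)) (k + 1) := rfl
    rw [hsucc]
    by_cases hreg : CfRegular lam (k + 1)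
    · obtain ⟨h1, h2, -⟩ := ih.finite hreg
      rw [h1, if_neg (lt_irrefl 0)]
      set M := (cfData lam k).2.2
      by_cases hlam : lam = 0
      · subst hlam
        have hk : k = 0 := by
          by_contra hk
          exact hreg [1] (by simp; omega) cfFrac_zero_singleton
        subst hk
        refine cfSearch_correct (fun _ _ => ⟨[1], ⟨rfl, ?_⟩, cfFrac_zero_singleton⟩)
          (fun h => absurd cfFrac_zero_singleton (h [1] (by simp))) hreg
        simpa using one_le_cfLevel 0 M 1
      · have hM (l : List ℤ) (hl : l.length < k + 1) : cfSq lam l ≤ M := by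
          have := h2 (l ++ List.replicate (k - l.length) 0) (by simp; omega)
          rwa [cfSq, cfFrac_append_replicate_zero] at this
        refine cfSearch_correct (fun _ h => ?_) (fun h l hl => ?_) hreg
        · obtain ⟨l, hl, h0⟩ := exists_length_eq_of_not_cfRegular_succ hreg h
          obtain ⟨l', hl', hle⟩ := exists_mem_cfBox_cfLevel hlam hreg hM hl
          rw [cfAbs_eq_top_iff.2 h0, top_le_iff, cfAbs_eq_top_iff] at hle
          exact ⟨l', hl', hle⟩
        · obtain ⟨l', hl', hle⟩ := exists_mem_cfBox_cfLevel hlam hreg hM hl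
          exact ⟨l', hl', (cfAbs_le_cfAbs_iff (h l (by omega)) (h l' (by rw [hl'.1]; omega))).1 hle⟩
    · obtain ⟨h1, -⟩ := ih.infinite hreg
      rw [h1, if_pos one_pos]
      have hreg' : ¬ CfRegular lam (k + 1 + 1) := fun h => hreg (h.mono (by omega))
      exact ⟨fun h => absurd h hreg', fun _ => ⟨rfl, rfl⟩, fun h => absurd h hreg⟩

theorem cfData_snd_fst (lam : ℂ) (k : ℕ) :
    (cfData lam k).2.1 = truthValue (¬ CfRegular lam (k + 1)) := by
  by_cases h : CfRegular lam (k + 1)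
  · simp [truthValue, h, ((cfData_correct lam k).finite h).1]
  · simp [truthValue, h, ((cfData_correct lam k).infinite h).1]

/-- The bounded search region contains a maximal continued fraction. -/
theorem exists_mem_cfBox_cfData {lam : ℂ} {k : ℕ} (hreg : CfRegular lam k) :
    ∃ l ∈ cfBox k (cfData lam k).1, ∀ l' : List ℤ, l'.length = k → cfAbs lam l' ≤ cfAbs lam l := by
  by_cases h : CfRegular lam (k + 1)
  · obtain ⟨-, h1, l, hl, h2⟩ := (cfData_correct lam k).finite h
    refine ⟨l, hl, fun l' hl' => ?_⟩
    rw [cfAbs_le_cfAbs_iff (h l' (by omega)) (h l (by rw [hl.1]; omega)), h2]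
    exact h1 l' hl'
  · obtain ⟨l, hl, h0⟩ := (cfData_correct lam k).exists_pole hreg h
    exact ⟨l, hl, fun l' _ => by rw [cfAbs_eq_top_iff.2 h0]; exact le_top⟩

theorem isGreatest_wcfMax {u : ℂ} (hu : -u ^ 2 ≠ 0) {k : ℕ} (hreg : CfRegular (-u ^ 2) k) :
    IsGreatest (cfAbs (-u ^ 2) '' {l : List ℤ | l.length = k}) (wcfMax u k) ∧
      IsGreatest (cfAbs (-u ^ 2) '' cfBox k (cfData (-u ^ 2) k).1) (wcfMax u k) := by
  obtain ⟨l, hl, hmax⟩ := exists_mem_cfBox_cfData hreg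
  have h1 : IsGreatest (cfAbs (-u ^ 2) '' {l : List ℤ | l.length = k}) (cfAbs (-u ^ 2) l) :=
    ⟨⟨l, hl.1, rfl⟩, by rintro _ ⟨l', hl', rfl⟩; exact hmax l' hl'⟩
  have h2 : wcfMax u k = cfAbs (-u ^ 2) l := by
    rw [wcfMax, if_neg, image_extSeqs hu hreg, h1.isLUB.sSup_eq]
    rintro ⟨j, hj, hroot⟩
    exact cfRegular_iff_forall_not_hasRootSeq.1 hreg j hj hroot
  rw [h2]
  exact ⟨h1, ⟨⟨l, hl, rfl⟩, by rintro _ ⟨l', hl', rfl⟩; exact hmax l' hl'.1⟩⟩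

theorem wcfMax_of_not_cfRegular {u : ℂ} {k : ℕ} (hreg : ¬ CfRegular (-u ^ 2) k) :
    wcfMax u k = ⊤ := by
  rw [cfRegular_iff_forall_not_hasRootSeq] at hreg
  push Not at hreg
  exact if_pos hreg

theorem wcfMax_eq_top_iff {u : ℂ} (hu : -u ^ 2 ≠ 0) {k : ℕ} :
    wcfMax u k = ⊤ ↔ ¬ CfRegular (-u ^ 2) (k + 1) := by
  by_cases hreg : CfRegular (-u ^ 2) k
  · obtain ⟨⟨⟨l, hl, h1⟩, h2⟩, -⟩ := isGreatest_wcfMax hu hreg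
    constructor
    · intro htop h
      rw [← h1, cfAbs_eq_top_iff] at htop
      exact h l (Nat.lt_succ_of_le hl.le) htop
    · intro h
      obtain ⟨l', hl', h0⟩ := exists_length_eq_of_not_cfRegular_succ hreg h
      have := h2 ⟨l', hl', rfl⟩
      rwa [cfAbs_eq_top_iff.2 h0, top_le_iff] at this
  · exact iff_of_true (wcfMax_of_not_cfRegular hreg) fun h => hreg (h.mono (Nat.le_succ k))

theorem toReal_wcfMax_sq {u : ℂ} (hu : -u ^ 2 ≠ 0) (k : ℕ) :
    (wcfMax u k).toReal ^ 2 = (cfData (-u ^ 2) k).2.2 := by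
  by_cases h : CfRegular (-u ^ 2) (k + 1)
  · obtain ⟨⟨⟨l, hl, h1⟩, h2⟩, -⟩ := isGreatest_wcfMax hu (h.mono (Nat.le_succ k))
    obtain ⟨-, h3, l', hl', h4⟩ := (cfData_correct (-u ^ 2) k).finite h
    have hl0 := h l (Nat.lt_succ_of_le hl.le)
    have hl0' := h l' (by rw [hl'.1]; omega)
    rw [← h1, toReal_cfAbs_sq hl0]
    refine le_antisymm (h3 l hl) ?_
    rw [← h4, ← cfAbs_le_cfAbs_iff hl0' hl0, h1]
    exact h2 ⟨l', hl'.1, rfl⟩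
  · rw [(wcfMax_eq_top_iff hu).2 h, ((cfData_correct (-u ^ 2) k).infinite h).2]
    simp

theorem isRelationNumber_and_minUDegree_eq_iff {u : ℂ} {k : ℕ} :
    IsRelationNumber (-u ^ 2) ∧ minUDegree u = k ↔
      CfRegular (-u ^ 2) k ∧ ¬ CfRegular (-u ^ 2) (k + 1) := by
  rw [← minUDegree_eq_iff]
  exact ⟨fun h => h.2, fun h => ⟨isRelationNumber_of_minUDegree_eq h, h⟩⟩

theorem truthValue_minUDegree_eq (u : ℂ) (k : ℕ) :
    truthValue (IsRelationNumber (-u ^ 2) ∧ minUDegree u = k) =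
      (cfData (-u ^ 2) k).2.1 - (cfData (-u ^ 2) (k - 1)).2.1 := by
  rw [isRelationNumber_and_minUDegree_eq_iff, cfData_snd_fst, cfData_snd_fst]
  cases k with
  | zero => simp [truthValue, cfRegular_one]
  | succ k =>
    rw [Nat.add_sub_cancel]
    by_cases h1 : CfRegular (-u ^ 2) (k + 1)
    · by_cases h2 : CfRegular (-u ^ 2) (k + 1 + 1) <;> simp [truthValue, h1, h2]
    · have h2 : ¬ CfRegular (-u ^ 2) (k + 1 + 1) := fun h => h1 (h.mono (Nat.le_succ _))
      simp [truthValue, h1, h2]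

theorem theoremC :
    ∃ A : RealProgram, ∀ (lam u : ℂ), lam = -u ^ 2 → ∀ k : ℕ,
      ∃ record : List ℝ,
        RealProgram.Runs A [lam.re, lam.im, (k : ℝ)]
          (truthValue (IsRelationNumber lam ∧ minUDegree u = (k : ℕ∞)) :: record) ∧
        (lam ≠ 0 →
          (∃ N : ℕ → ℕ,
            record = (List.range (k + 1)).flatMap (fun i =>
              [(N i : ℝ), truthValue (wcfMax u i = ⊤), (wcfMax u i).toReal ^ 2]) ∧
            ∀ i ≤ k, (i : ℕ∞) ≤ minUDegree u →
              IsGreatest ((fun L => sphereAbs (wcf lam L)) '' extSeqs i) (wcfMax u i) ∧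
              IsGreatest ((fun L => sphereAbs (wcf lam L)) '' boundedSeqs i (N i))
                (wcfMax u i)) ∧
          ((IsRelationNumber lam ∧ minUDegree u = (k : ℕ∞)) ↔
            wcfMax u k = ⊤ ∧ ∀ i < k, wcfMax u i ≠ ⊤)) := by
  obtain ⟨A, hA⟩ := exists_realProgram_cfOutput
  refine ⟨A, ?_⟩
  rintro lam u rfl k
  have hrun := hA (-u ^ 2) k
  rw [cfOutput, ← truthValue_minUDegree_eq] at hrun
  refine ⟨_, hrun, fun hlam => ⟨⟨fun i => (cfData (-u ^ 2) i).1, ?_, fun i _ hi => ?_⟩, ?_⟩⟩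
  · simp only [cfData_snd_fst, wcfMax_eq_top_iff hlam, toReal_wcfMax_sq hlam]
  · have hreg := natCast_le_minUDegree_iff_cfRegular.1 hi
    rw [image_extSeqs hlam hreg, image_boundedSeqs hlam _ hreg]
    exact isGreatest_wcfMax hlam hreg
  · rw [isRelationNumber_and_minUDegree_eq_iff, wcfMax_eq_top_iff hlam, and_comm]
    refine and_congr_right fun _ => ?_
    simp only [ne_eq, wcfMax_eq_top_iff hlam, not_not]
    constructor
    · exact fun h i hi => h.mono hi
    · intro h
      cases k with
      | zero => exact (cfRegular_one _).mono zero_le_one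
      | succ k => exact h k (Nat.lt_succ_self k)
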